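/- Consider majority dynamics on a finite graph $G$ all of whose degrees are odd: given initial opinions $\xi_0\in\{-1,1\}^{V(G)}$, at every time step $t\ge 1$ each vertex $i$ adopts $\xi_t(i)=\mathrm{sign}\sum_{j\sim i}\xi_{t-1}(j)$, the sum being over the neighbours $j$ of $i$, and the stabilisation time is $\tau(G;\xi_0)=\min\{t\ge 0:\ \xi_{t+2}(i)=\xi_t(i)\text{ for all }i\in V(G)\}$. A perfect $k$-ary tree is a finite rooted tree in which every vertex other than the leaves (the root included) has exactly $k+1$ neighbours, and all leaves are at the same distance from the root; $D(T)$ denotes the diameter of $T$. There exists a constant $c_->0$ such that, for every even $k\ge 4$, if $T$ is a perfect $k$-ary tree and $\xi_0\in\{-1,1\}^{V(T)}$ is chosen uniformly at random, then with probability tending to $1$ as $D(T)\to\infty$ (with $k$ fixed), the stabilisation time exists and $$ c_-\cdot\frac{\sqrt{\ln k}}{k}\sqrt{D(T)}<\tau(T;\xi_0)\le D(T)-3 . $$ -/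

import Mathlib

/-- One step of majority dynamics. Opinions are the units `1, -1` of `ℤ`, and each vertex takes
the sign of the sum of the opinions of its neighbours. When all degrees are odd this sum is
never `0`, so the `else` branch is exactly the case of a negative sum. -/
def majorityStep {V : Type*} [Fintype V] (G : SimpleGraph V) [DecidableRel G.Adj]
    (ξ : V → ℤˣ) : V → ℤˣ :=
  fun i => if 0 < ∑ j ∈ G.neighborFinset i, (ξ j : ℤ) then 1 else -1

/-- The vector of opinions `ξ_t` at time `t`, started from `ξ₀`. -/
def opinionAt {V : Type*} [Fintype V] (G : SimpleGraph V) [DecidableRel G.Adj]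
    (ξ₀ : V → ℤˣ) : ℕ → V → ℤˣ
  | 0 => ξ₀
  | t + 1 => majorityStep G (opinionAt G ξ₀ t)

/-- `τ` is the stabilisation time of `G` from `ξ₀`: the minimum, which is required to exist,
of all `t` such that `ξ_{t+2}(i) = ξ_t(i)` for all vertices `i`. -/
def IsStabilisationTime {V : Type*} [Fintype V] (G : SimpleGraph V) [DecidableRel G.Adj]
    (ξ₀ : V → ℤˣ) (τ : ℕ) : Prop :=
  IsLeast {t : ℕ | ∀ i : V, opinionAt G ξ₀ (t + 2) i = opinionAt G ξ₀ t i} τ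

/-- The tree `T` rooted in `R` is a perfect `k`-ary tree: every vertex that is not a leaf
(a leaf is a vertex of degree `1`), the root included, has `k + 1` neighbours, and all leaves
are at the same distance from the root. -/
structure IsPerfectKAryTree {V : Type*} [Fintype V] (T : SimpleGraph V) [DecidableRel T.Adj]
    (R : V) (k : ℕ) : Prop where
  isTree : T.IsTree
  degree_eq : ∀ v : V, T.degree v ≠ 1 → T.degree v = k + 1
  leaf_dist : ∀ u v : V, T.degree u = 1 → T.degree v = 1 → T.dist R u = T.dist R v

/-- The probability that a uniformly random `ξ₀ ∈ {-1, 1}^V` lies in `A`. -/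
noncomputable def uniformProb {V : Type*} [Fintype V] [DecidableEq V]
    (A : Set (V → ℤˣ)) : ℝ :=
  ((PMF.uniformOfFintype (V → ℤˣ)).toOuterMeasure A).toReal

/-! Let `n` be the depth of the leaves, so that the diameter is `2 * n`.

Upper bound. Call it a flip at `v` at time `t` when the opinions of `v` at `t` and `t + 2` differ. A
flip at time `t + 1` is caused by a neighbour flipping at time `t` in the same direction
(`exists_adj_of_majorityStep_ne`). A flip received from the parent cannot be handed back to the
parent, since it repeats a value the parent already had. So causal chains climb and then descend.
Parents of leaves never flip, so both legs have at most `n - 2` edges, and no flip occurs after time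
`2 * n - 4` (`flip_bound`).

Lower bound. Take a descending path whose off-path children are frozen with total opinion `1`. A
path vertex then takes opinion `1` exactly when its parent or its path child has it. If only the
bottom of the path starts at `1` and the vertex above the path stays at `-1`, a front climbs one
edge per step and flips the top of the path at a late, prescribed time
(`exists_opinionAt_ne_of_mem_topEvent`).

Freezing one vertex until time `L` costs probability at least `2 ^ (-(1 + k * L))`: with that vertex
forced, each child agrees with it at each time with probability at least `1 / 2`, and Harris'
inequality multiplies these bounds. Disjoint subtrees are independent, so a wave of length `L` has
probability `2 ^ (-O((k * L) ^ 2))`. There are at least `k ^ m` independent places for it at depth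
`m`, with `m` close to `n`. One succeeds with high probability once `(k * L) ^ 2` is a small
multiple of `n * log k`. -/

/-- `par` and `d` are the parent and depth functions of the graph `T` rooted in `R`, the parent of
the root being the root itself. -/
structure IsRooting {V : Type*} (T : SimpleGraph V) (R : V) (par : V → V) (d : V → ℕ) :
    Prop where
  depth_eq_zero : ∀ v, d v = 0 ↔ v = R
  depth_par : ∀ v, d (par v) = d v - 1
  adj_iff : ∀ u v, T.Adj u v ↔ (v ≠ R ∧ par v = u) ∨ (u ≠ R ∧ par u = v)

/-- The vertices other than the root whose parent is `v`. -/
def childrenOf {V : Type*} [Fintype V] [DecidableEq V] (R : V) (par : V → V) (v : V) : Finset V :=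
  Finset.univ.filter fun x => x ≠ R ∧ par x = v

/-- The descendants of `x`, including `x` itself. -/
def descendants {V : Type*} (par : V → V) (x : V) : Set V := {v | ∃ j : ℕ, par^[j] v = x}

/-! ### Rooting a tree by distance to the root. -/

/-- Geodesics to both candidates extend to paths ending at `v`; paths in a tree are unique, so their
penultimate vertices agree. This makes the parent well defined. -/
theorem SimpleGraph.IsTree.eq_of_adj_of_dist_add_one {V : Type*} {T : SimpleGraph V}
    (hT : T.IsTree) {R u₁ u₂ v : V} (h₁ : T.Adj v u₁) (h₂ : T.Adj v u₂)
    (hd₁ : T.dist R u₁ + 1 = T.dist R v) (hd₂ : T.dist R u₂ + 1 = T.dist R v) : u₁ = u₂ := by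
  obtain ⟨p₁, hp₁⟩ := hT.connected.exists_walk_length_eq_dist R u₁
  obtain ⟨p₂, hp₂⟩ := hT.connected.exists_walk_length_eq_dist R u₂
  have hq₁ : (p₁.concat h₁.symm).IsPath :=
    SimpleGraph.Walk.isPath_of_length_eq_dist _ (by rw [SimpleGraph.Walk.length_concat]; omega)
  have hq₂ : (p₂.concat h₂.symm).IsPath :=
    SimpleGraph.Walk.isPath_of_length_eq_dist _ (by rw [SimpleGraph.Walk.length_concat]; omega)
  have h := (hT.existsUnique_path R v).unique hq₁ hq₂
  have := congrArg SimpleGraph.Walk.penultimate h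
  simpa using this

theorem SimpleGraph.Connected.exists_adj_dist_add_one {V : Type*} {T : SimpleGraph V}
    (hT : T.Connected) {R v : V} (hv : v ≠ R) : ∃ u, T.Adj v u ∧ T.dist R u + 1 = T.dist R v := by
  obtain ⟨p, hp⟩ := hT.exists_walk_length_eq_dist v R
  cases p with
  | nil => exact absurd rfl hv
  | cons h q =>
    rename_i w
    refine ⟨w, h, ?_⟩
    rw [SimpleGraph.Walk.length_cons] at hp
    have h1 : T.dist R w ≤ q.length := by
      rw [SimpleGraph.dist_comm]; exact SimpleGraph.dist_le q
    have h2 : T.dist R v ≤ T.dist R w + T.dist w v := hT.dist_triangle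
    have h3 : T.dist w v = 1 := SimpleGraph.dist_eq_one_iff_adj.2 h.symm
    rw [SimpleGraph.dist_comm] at hp
    omega

theorem SimpleGraph.IsTree.exists_isRooting {V : Type*} {T : SimpleGraph V} (hT : T.IsTree)
    (R : V) : ∃ par : V → V, IsRooting T R par (T.dist R) := by
  classical
  have hex : ∀ v, ∃ u, (v = R → u = R) ∧
      (v ≠ R → T.Adj v u ∧ T.dist R u + 1 = T.dist R v) := by
    intro v
    by_cases hv : v = R
    · exact ⟨R, fun _ => rfl, fun h => absurd hv h⟩
    · obtain ⟨u, hu⟩ := hT.connected.exists_adj_dist_add_one hv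
      exact ⟨u, fun h => absurd h hv, fun _ => hu⟩
  choose par hR hpar using hex
  have h0 : ∀ v, T.dist R v = 0 ↔ v = R := by
    intro v
    rw [hT.connected.dist_eq_zero_iff, eq_comm]
  refine ⟨par, h0, ?_, ?_⟩
  · intro v
    by_cases hv : v = R
    · rw [hR v hv, hv]; simp
    · have := (hpar v hv).2; omega
  · intro u v
    constructor
    · intro h
      rcases hT.dist_eq_dist_add_one_of_adj R h with h' | h'
      · have hu : u ≠ R := by
          intro hu; have := (h0 u).2 hu; omega
        exact Or.inr ⟨hu, hT.eq_of_adj_of_dist_add_one (hpar u hu).1 h (hpar u hu).2 h'.symm⟩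
      · have hv : v ≠ R := by
          intro hv; have := (h0 v).2 hv; omega
        exact Or.inl ⟨hv, hT.eq_of_adj_of_dist_add_one (hpar v hv).1 h.symm (hpar v hv).2 h'.symm⟩
    · rintro (⟨hv, rfl⟩ | ⟨hu, rfl⟩)
      · exact (hpar v hv).1.symm
      · exact (hpar u hu).1

namespace IsRooting

variable {V : Type*} {T : SimpleGraph V} {R : V} {par : V → V} {d : V → ℕ}

theorem depth_pos (h : IsRooting T R par d) {v : V} (hv : v ≠ R) : 0 < d v :=
  Nat.pos_of_ne_zero fun h0 => hv ((h.depth_eq_zero v).1 h0)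

theorem ne_root (h : IsRooting T R par d) {v : V} (hv : 0 < d v) : v ≠ R := fun h0 =>
  hv.ne' ((h.depth_eq_zero v).2 h0)

theorem depth_par_add_one (h : IsRooting T R par d) {v : V} (hv : v ≠ R) :
    d (par v) + 1 = d v := by
  have := h.depth_par v
  have := h.depth_pos hv
  omega

theorem depth_iterate_par (h : IsRooting T R par d) (j : ℕ) (v : V) :
    d (par^[j] v) = d v - j := by
  induction j with
  | zero => simp
  | succ j ih => rw [Function.iterate_succ_apply', h.depth_par, ih]; omega

theorem self_mem_descendants (x : V) : x ∈ descendants par x := ⟨0, rfl⟩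

theorem descendants_subset {x v : V} (hx : x ∈ descendants par v) :
    descendants par x ⊆ descendants par v := by
  obtain ⟨i, hi⟩ := hx
  rintro u ⟨j, hj⟩
  exact ⟨i + j, by rw [Function.iterate_add_apply, hj, hi]⟩

theorem disjoint_descendants (h : IsRooting T R par d) {x y : V} (hd : d x = d y) (hxy : x ≠ y) :
    Disjoint (descendants par x) (descendants par y) := by
  rw [Set.disjoint_left]
  rintro v ⟨i, hi⟩ ⟨j, hj⟩
  apply hxy
  have h1 := h.depth_iterate_par i v
  have h2 := h.depth_iterate_par j v
  rw [hi] at h1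
  rw [hj] at h2
  -- At depth `0` the number of steps is not determined by depths, because the root is its own
  -- parent.
  by_cases h0 : d x = 0
  · rw [(h.depth_eq_zero x).1 h0, (h.depth_eq_zero y).1 (by omega)]
  · have : i = j := by omega
    rw [← hi, ← hj, this]

/-- The only exit from a subtree is the parent of its top; this is what makes subtrees independent
once that parent is forced. -/
theorem adj_descendants (h : IsRooting T R par d) {x u v : V} (hv : v ∈ descendants par x)
    (huv : T.Adj v u) : u ∈ descendants par x ∨ u = par x := by
  obtain ⟨j, hj⟩ := hv
  rcases (h.adj_iff v u).1 huv with ⟨_, hu⟩ | ⟨_, hu⟩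
  · exact Or.inl ⟨j + 1, by rw [Function.iterate_succ_apply, hu, hj]⟩
  · cases j with
    | zero => right; rw [← hu]; rw [Function.iterate_zero, id] at hj; rw [hj]
    | succ j => left; exact ⟨j, by rw [← hu, ← Function.iterate_succ_apply, hj]⟩

theorem depth_le_of_mem_descendants (h : IsRooting T R par d) {x v : V}
    (hv : v ∈ descendants par x) : d x ≤ d v := by
  obtain ⟨j, rfl⟩ := hv
  rw [h.depth_iterate_par]
  omega

variable [Fintype V] [DecidableEq V]

theorem _root_.mem_childrenOf {v x : V} : x ∈ childrenOf R par v ↔ x ≠ R ∧ par x = v := by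
  simp [childrenOf]

theorem depth_of_mem_childrenOf (h : IsRooting T R par d) {v x : V}
    (hx : x ∈ childrenOf R par v) : d x = d v + 1 := by
  obtain ⟨h1, rfl⟩ := mem_childrenOf.1 hx
  exact (h.depth_par_add_one h1).symm

theorem mem_descendants_of_mem_childrenOf {v x : V} (hx : x ∈ childrenOf R par v) :
    x ∈ descendants par v :=
  ⟨1, (mem_childrenOf.1 hx).2⟩

theorem notMem_descendants_child (h : IsRooting T R par d) {v x : V}
    (hx : x ∈ childrenOf R par v) : v ∉ descendants par x := by
  intro hv
  have := h.depth_le_of_mem_descendants hv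
  have := h.depth_of_mem_childrenOf hx
  omega

theorem par_notMem_childrenOf (h : IsRooting T R par d) {v : V} (hv : v ≠ R) :
    par v ∉ childrenOf R par v := by
  intro hp
  have := h.depth_of_mem_childrenOf hp
  have := h.depth_par_add_one hv
  omega

variable [DecidableRel T.Adj]

theorem neighborFinset_root (h : IsRooting T R par d) :
    T.neighborFinset R = childrenOf R par R := by
  ext u
  rw [SimpleGraph.mem_neighborFinset, mem_childrenOf, h.adj_iff]
  simp

theorem neighborFinset_eq (h : IsRooting T R par d) {v : V} (hv : v ≠ R) :
    T.neighborFinset v = insert (par v) (childrenOf R par v) := by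
  ext u
  rw [SimpleGraph.mem_neighborFinset, Finset.mem_insert, mem_childrenOf, h.adj_iff]
  constructor
  · rintro (h | ⟨_, h⟩)
    · exact Or.inr h
    · exact Or.inl h.symm
  · rintro (h | h)
    · exact Or.inr ⟨hv, h.symm⟩
    · exact Or.inl h

theorem childrenOf_subset_neighborFinset (h : IsRooting T R par d) (v : V) :
    childrenOf R par v ⊆ T.neighborFinset v := by
  by_cases hv : v = R
  · rw [hv, h.neighborFinset_root]
  · rw [h.neighborFinset_eq hv]; exact Finset.subset_insert _ _

theorem sum_neighborFinset (h : IsRooting T R par d) {v : V} (hv : v ≠ R) (f : V → ℤ) :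
    ∑ u ∈ T.neighborFinset v, f u = f (par v) + ∑ u ∈ childrenOf R par v, f u := by
  rw [h.neighborFinset_eq hv, Finset.sum_insert (h.par_notMem_childrenOf hv)]

theorem degree_eq_card_childrenOf_add_one (h : IsRooting T R par d) {v : V} (hv : v ≠ R) :
    T.degree v = (childrenOf R par v).card + 1 := by
  rw [← SimpleGraph.card_neighborFinset_eq_degree, h.neighborFinset_eq hv,
    Finset.card_insert_of_notMem (h.par_notMem_childrenOf hv)]

theorem degree_root (h : IsRooting T R par d) : T.degree R = (childrenOf R par R).card := by
  rw [← SimpleGraph.card_neighborFinset_eq_degree, h.neighborFinset_root]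

end IsRooting

/-! ### Perfect trees: level sizes and diameter. -/

/-- A rooting of a perfect `k`-ary tree whose leaves are at distance `n` from the root. -/
structure IsPerfectRooting {V : Type*} [Fintype V] (T : SimpleGraph V) [DecidableRel T.Adj]
    (R : V) (k n : ℕ) (par : V → V) (d : V → ℕ) : Prop extends IsRooting T R par d where
  depth_le : ∀ v, d v ≤ n
  degree_leaf : ∀ v, d v = n → T.degree v = 1
  degree_inner : ∀ v, d v < n → T.degree v = k + 1

namespace IsPerfectRooting

variable {V : Type*} [Fintype V] {T : SimpleGraph V} [DecidableRel T.Adj] {R : V} {k n : ℕ}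
  {par : V → V} {d : V → ℕ}

theorem odd_degree (h : IsPerfectRooting T R k n par d) (hk : Even k) (v : V) :
    Odd (T.degree v) := by
  rcases (h.depth_le v).lt_or_eq with h1 | h1
  · rw [h.degree_inner v h1]; exact hk.add_one
  · rw [h.degree_leaf v h1]; exact odd_one

variable [DecidableEq V]

theorem card_childrenOf (h : IsPerfectRooting T R k n par d) {v : V} (hv : v ≠ R) (hd : d v < n) :
    (childrenOf R par v).card = k := by
  have h1 := h.degree_eq_card_childrenOf_add_one hv
  have h2 := h.degree_inner v hd
  omega

theorem le_card_childrenOf (h : IsPerfectRooting T R k n par d) {v : V} (hd : d v < n) :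
    k ≤ (childrenOf R par v).card := by
  by_cases hv : v = R
  · subst hv
    have h1 := h.degree_root
    have h2 := h.degree_inner v hd
    omega
  · exact (h.card_childrenOf hv hd).ge

theorem pow_le_card_depth (h : IsPerfectRooting T R k n par d) {m : ℕ} (hm : m ≤ n) :
    k ^ m ≤ (Finset.univ.filter fun v => d v = m).card := by
  induction m with
  | zero =>
    rw [pow_zero, Nat.one_le_iff_ne_zero, Finset.card_ne_zero]
    exact ⟨R, by simp [(h.depth_eq_zero R).2 rfl]⟩
  | succ m ih =>
    have hsub : (Finset.univ.filter fun v => d v = m).biUnion (childrenOf R par) ⊆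
        Finset.univ.filter fun v => d v = m + 1 := by
      intro x hx
      simp only [Finset.mem_biUnion, Finset.mem_filter, Finset.mem_univ, true_and] at hx ⊢
      obtain ⟨v, hv, hx⟩ := hx
      rw [h.depth_of_mem_childrenOf hx, hv]
    refine le_trans ?_ (Finset.card_le_card hsub)
    rw [Finset.card_biUnion]
    · calc k ^ (m + 1) = k ^ m * k := pow_succ _ _
        _ ≤ (Finset.univ.filter fun v => d v = m).card * k :=
            Nat.mul_le_mul_right _ (ih (by omega))
        _ ≤ _ := by
            rw [← smul_eq_mul]
            apply Finset.card_nsmul_le_sum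
            intro v hv
            apply h.le_card_childrenOf
            have := (Finset.mem_filter.1 hv).2
            omega
    · intro u _ v _ huv
      change Disjoint (childrenOf R par u) (childrenOf R par v)
      rw [Finset.disjoint_left]
      intro x hx hx'
      exact huv ((mem_childrenOf.1 hx).2.symm.trans (mem_childrenOf.1 hx').2)

theorem exists_descendant_depth (h : IsPerfectRooting T R k n par d) (hk : 0 < k) (x : V) :
    ∃ u ∈ descendants par x, d u = n := by
  suffices H : ∀ j, d x + j ≤ n → ∃ u ∈ descendants par x, d u = d x + j by
    obtain ⟨u, hu, hu'⟩ := H (n - d x) (by have := h.depth_le x; omega)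
    exact ⟨u, hu, by have := h.depth_le x; omega⟩
  intro j
  induction j with
  | zero => intro _; exact ⟨x, IsRooting.self_mem_descendants x, rfl⟩
  | succ j ih =>
    intro hj
    obtain ⟨u, hu, hd⟩ := ih (by omega)
    have hc := h.le_card_childrenOf (v := u) (by omega)
    obtain ⟨y, hy⟩ := Finset.card_pos.1 (hk.trans_le hc)
    refine ⟨y, IsRooting.descendants_subset hu
      (IsRooting.mem_descendants_of_mem_childrenOf hy), ?_⟩
    rw [h.depth_of_mem_childrenOf hy]
    omega

end IsPerfectRooting

theorem SimpleGraph.Walk.abs_sub_le_length {V : Type*} {G : SimpleGraph V} {f : V → ℤ}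
    (hf : ∀ u v, G.Adj u v → |f u - f v| ≤ 1) {u v : V} (p : G.Walk u v) :
    |f u - f v| ≤ p.length := by
  induction p with
  | nil => simp
  | cons hadj q ih =>
    rename_i a b c
    rw [SimpleGraph.Walk.length_cons]
    push_cast
    have := hf _ _ hadj
    have h3 := abs_sub_le (f a) (f b) (f c)
    linarith

namespace IsPerfectKAryTree

variable {V : Type*} [Fintype V] [DecidableEq V] {T : SimpleGraph V} [DecidableRel T.Adj]
  {R : V} {k : ℕ}

/-- A deepest vertex has no children, hence is a leaf, so the common depth of the leaves is the
maximal depth. -/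
theorem exists_isPerfectRooting (h : IsPerfectKAryTree T R k) (hk : 0 < k) :
    ∃ n par, IsPerfectRooting T R k n par (T.dist R) := by
  obtain ⟨par, hpar⟩ := h.isTree.exists_isRooting R
  obtain ⟨w, -, hw⟩ := Finset.exists_max_image Finset.univ (T.dist R) ⟨R, Finset.mem_univ R⟩
  have hc : (childrenOf R par w) = ∅ := by
    rw [Finset.eq_empty_iff_forall_notMem]
    intro x hx
    have := hpar.depth_of_mem_childrenOf hx
    have := hw x (Finset.mem_univ _)
    omega
  have hwl : T.degree w = 1 := by
    by_contra hne
    have h1 := h.degree_eq w hne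
    by_cases hR : w = R
    · subst hR
      rw [hpar.degree_root, hc, Finset.card_empty] at h1
      omega
    · rw [hpar.degree_eq_card_childrenOf_add_one hR, hc, Finset.card_empty] at h1
      omega
  have hleaf : ∀ v, T.degree v = 1 → T.dist R v = T.dist R w := fun v hv => h.leaf_dist v w hv hwl
  have hRw : R ≠ w := by
    rintro rfl
    rw [hpar.degree_root, hc] at hwl
    simp at hwl
  refine ⟨T.dist R w, par, hpar, fun v => hw v (Finset.mem_univ _), ?_, ?_⟩
  · intro v hv
    have hvR : v ≠ R := hpar.ne_root (by rw [hv]; exact hpar.depth_pos hRw.symm)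
    have hcv : (childrenOf R par v) = ∅ := by
      rw [Finset.eq_empty_iff_forall_notMem]
      intro x hx
      have := hpar.depth_of_mem_childrenOf hx
      have := hw x (Finset.mem_univ _)
      omega
    rw [hpar.degree_eq_card_childrenOf_add_one hvR, hcv, Finset.card_empty]
  · intro v hv
    exact h.degree_eq v fun hv1 => hv.ne (hleaf v hv1)

/-- For the lower bound, take the depth with positive sign below one child of the root and negative
sign elsewhere. This function is 1-Lipschitz and differs by `2 * n` between leaves below two
distinct children. -/
theorem diam_eq {n : ℕ} {par : V → V} (hT : T.IsTree)
    (h : IsPerfectRooting T R k n par (T.dist R)) (hk : 2 ≤ k) (hn : 0 < n) :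
    T.diam = 2 * n := by
  have hne : Nonempty V := ⟨R⟩
  apply le_antisymm
  · obtain ⟨u, v, huv⟩ := T.exists_dist_eq_diam
    rw [← huv]
    have h1 : T.dist u v ≤ T.dist u R + T.dist R v := hT.connected.dist_triangle
    rw [T.dist_comm (u := u) (v := R)] at h1
    have := h.depth_le u
    have := h.depth_le v
    omega
  · have hR0 : T.dist R R = 0 := by simp
    have hc := h.le_card_childrenOf (v := R) (by omega)
    obtain ⟨x, hx, y, hy, hxy⟩ := Finset.one_lt_card.1 (lt_of_lt_of_le (by omega : 1 < k) hc)
    obtain ⟨u, hu, hdu⟩ := h.exists_descendant_depth (by omega) x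
    obtain ⟨v, hv, hdv⟩ := h.exists_descendant_depth (by omega) y
    have hdx : T.dist R x = 1 := by rw [h.depth_of_mem_childrenOf hx, hR0]
    have hdy : T.dist R y = 1 := by rw [h.depth_of_mem_childrenOf hy, hR0]
    have hvx : v ∉ descendants par x := fun hvx =>
      Set.disjoint_left.1 (h.disjoint_descendants (by omega) hxy) hvx hv
    classical
    let f : V → ℤ := fun w => if w ∈ descendants par x then (T.dist R w : ℤ) else -(T.dist R w : ℤ)
    have hpx : par x = R := (mem_childrenOf.1 hx).2
    have hcross : ∀ a b, T.Adj a b → a ∈ descendants par x → b ∉ descendants par x →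
        |f a - f b| ≤ 1 := by
      intro a b hab ha hb
      have hbR : b = R := ((h.adj_descendants ha hab).resolve_left hb).trans hpx
      have had : T.dist R a = 1 := by
        rw [SimpleGraph.dist_eq_one_iff_adj]; exact hbR ▸ hab.symm
      simp only [f, if_pos ha, had, hbR, hR0]
      norm_num
    have hf : ∀ a b, T.Adj a b → |f a - f b| ≤ 1 := by
      intro a b hab
      have hstep := hT.dist_eq_dist_add_one_of_adj R hab
      by_cases ha : a ∈ descendants par x <;> by_cases hb : b ∈ descendants par x
      · simp only [f, if_pos ha, if_pos hb]
        rw [abs_le]; omega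
      · exact hcross a b hab ha hb
      · rw [abs_sub_comm]; exact hcross b a hab.symm hb ha
      · simp only [f, if_neg ha, if_neg hb]
        rw [abs_le]; omega
    obtain ⟨p, hp⟩ := hT.connected.exists_walk_length_eq_dist u v
    have h1 := p.abs_sub_le_length hf
    simp only [f, if_pos hu, if_neg hvx, hdu, hdv, hp] at h1
    have h2 := (abs_le.1 h1).2
    have hdiam : T.dist u v ≤ T.diam := by
      apply SimpleGraph.dist_le_diam
      have : Nontrivial V := ⟨x, y, hxy⟩
      exact SimpleGraph.connected_iff_ediam_ne_top.1 hT.connected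
    omega

end IsPerfectKAryTree

/-! ### Uniform measure: independence and positive correlation. -/

theorem dependsOn_eval {V : Type*} (v : V) (s : ℤˣ) :
    DependsOn (fun ξ : V → ℤˣ => ξ ∈ {ξ | ξ v = s}) {v} := by
  intro ξ η h
  simp only [Set.mem_ofPred_eq]
  rw [h v rfl]

theorem dependsOn_mem_biInter {V ι : Type*} {I : Finset ι} {A : ι → Set (V → ℤˣ)} {S : ι → Set V}
    (hA : ∀ i ∈ I, DependsOn (fun ξ => ξ ∈ A i) (S i)) :
    DependsOn (fun ξ => ξ ∈ ⋂ i ∈ I, A i) (⋃ i ∈ I, S i) := by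
  intro ξ η h
  simp only [Set.mem_iInter, eq_iff_iff]
  refine forall₂_congr fun i hi => ?_
  have := hA i hi (x := ξ) (y := η) fun v hv => h v (Set.mem_biUnion hi hv)
  simpa using this

section UniformProb

variable {V : Type*} [Fintype V] [DecidableEq V]

theorem uniformProb_eq_ncard_div (A : Set (V → ℤˣ)) :
    uniformProb A = A.ncard / Fintype.card (V → ℤˣ) := by
  classical
  rw [uniformProb, PMF.toOuterMeasure_uniformOfFintype_apply, ENNReal.toReal_div,
    ENNReal.toReal_natCast, ENNReal.toReal_natCast, ← Nat.card_eq_fintype_card (α := A),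
    Nat.card_coe_set_eq]

theorem card_config_pos : (0 : ℝ) < Fintype.card (V → ℤˣ) := by
  exact_mod_cast Fintype.card_pos

theorem uniformProb_nonneg (A : Set (V → ℤˣ)) : 0 ≤ uniformProb A := ENNReal.toReal_nonneg

theorem uniformProb_mono {A B : Set (V → ℤˣ)} (h : A ⊆ B) : uniformProb A ≤ uniformProb B := by
  rw [uniformProb_eq_ncard_div, uniformProb_eq_ncard_div]
  have := Set.ncard_le_ncard h (Set.toFinite B)
  gcongr

theorem uniformProb_univ : uniformProb (Set.univ : Set (V → ℤˣ)) = 1 := by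
  rw [uniformProb_eq_ncard_div, Set.ncard_univ, Nat.card_eq_fintype_card]
  exact div_self card_config_pos.ne'

theorem uniformProb_compl (A : Set (V → ℤˣ)) : uniformProb Aᶜ = 1 - uniformProb A := by
  have h := Set.ncard_add_ncard_compl A
  rw [Nat.card_eq_fintype_card] at h
  rw [uniformProb_eq_ncard_div, uniformProb_eq_ncard_div, eq_sub_iff_add_eq, ← add_div,
    div_eq_one_iff_eq card_config_pos.ne']
  norm_cast
  omega

theorem uniformProb_preimage_neg (A : Set (V → ℤˣ)) :
    uniformProb {ξ | -ξ ∈ A} = uniformProb A := by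
  rw [uniformProb_eq_ncard_div, uniformProb_eq_ncard_div]
  congr 2
  have : {ξ | -ξ ∈ A} = (fun ξ : V → ℤˣ => -ξ) '' A := by
    ext ξ
    simp
  rw [this, Set.ncard_image_of_injective _ neg_injective]

theorem uniformProb_eval (v : V) (s : ℤˣ) : uniformProb {ξ : V → ℤˣ | ξ v = s} = 1 / 2 := by
  have h1 : ({ξ : V → ℤˣ | ξ v = s})ᶜ = {ξ | -ξ ∈ {ξ : V → ℤˣ | ξ v = s}} := by
    ext ξ
    rcases Int.units_eq_one_or (ξ v) with h | h <;> rcases Int.units_eq_one_or s with h' | h' <;>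
      simp [h, h']
  have h2 := uniformProb_compl {ξ : V → ℤˣ | ξ v = s}
  rw [h1, uniformProb_preimage_neg] at h2
  linarith

/-- Events which depend on disjoint sets of vertices are independent. -/
theorem uniformProb_inter_of_dependsOn {A B : Set (V → ℤˣ)} {S S' : Set V}
    (hA : DependsOn (fun ξ => ξ ∈ A) S) (hB : DependsOn (fun ξ => ξ ∈ B) S')
    (hSS' : Disjoint S S') : uniformProb (A ∩ B) = uniformProb A * uniformProb B := by
  classical
  -- Exchanging the coordinates outside `S` between two copies, up to order, is an involution
  -- matching `A ×ˢ B` with `(A ∩ B) ×ˢ univ`; counting gives independence.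
  let mix : (V → ℤˣ) × (V → ℤˣ) → (V → ℤˣ) × (V → ℤˣ) := fun p =>
    (fun v => if v ∈ S then p.1 v else p.2 v, fun v => if v ∈ S then p.2 v else p.1 v)
  have hinv : Function.Involutive mix := by
    rintro ⟨x, y⟩
    ext v <;> by_cases hv : v ∈ S <;> simp [mix, hv]
  have hpre : mix ⁻¹' ((A ∩ B) ×ˢ Set.univ) = A ×ˢ B := by
    ext ⟨x, y⟩
    simp only [Set.mem_preimage, Set.mem_prod, Set.mem_inter_iff, Set.mem_univ, and_true, mix]
    have e1 := hA (x := fun v => if v ∈ S then x v else y v) (y := x) (fun i hi => by simp [hi])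
    have e2 := hB (x := fun v => if v ∈ S then x v else y v) (y := y)
      (fun i hi => by simp [Set.disjoint_right.1 hSS' hi])
    simp only at e1 e2
    rw [e1, e2]
  have hcard := Set.ncard_preimage_of_injective_subset_range (f := mix)
    (s := (A ∩ B) ×ˢ Set.univ) hinv.injective (by rw [hinv.surjective.range_eq]; simp)
  rw [hpre, Set.ncard_prod, Set.ncard_prod, Set.ncard_univ, Nat.card_eq_fintype_card] at hcard
  rw [uniformProb_eq_ncard_div, uniformProb_eq_ncard_div, uniformProb_eq_ncard_div,
    div_mul_div_comm, div_eq_div_iff card_config_pos.ne'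
      (mul_pos card_config_pos card_config_pos).ne']
  have : (A.ncard : ℝ) * B.ncard = (A ∩ B).ncard * Fintype.card (V → ℤˣ) := by
    exact_mod_cast hcard
  rw [this]
  ring

theorem uniformProb_biInter_of_dependsOn {ι : Type*} (I : Finset ι) {A : ι → Set (V → ℤˣ)}
    {S : ι → Set V} (hA : ∀ i ∈ I, DependsOn (fun ξ => ξ ∈ A i) (S i))
    (hS : ∀ i ∈ I, ∀ j ∈ I, i ≠ j → Disjoint (S i) (S j)) :
    uniformProb (⋂ i ∈ I, A i) = ∏ i ∈ I, uniformProb (A i) := by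
  classical
  induction I using Finset.induction_on with
  | empty => simp [uniformProb_univ]
  | insert a I ha ih =>
    rw [Finset.prod_insert ha, Finset.set_biInter_insert, ← ih
      (fun i hi => hA i (Finset.mem_insert_of_mem hi))
      (fun i hi j hj => hS i (Finset.mem_insert_of_mem hi) j (Finset.mem_insert_of_mem hj))]
    refine uniformProb_inter_of_dependsOn (hA a (Finset.mem_insert_self a I))
      (dependsOn_mem_biInter fun i hi => hA i (Finset.mem_insert_of_mem hi)) ?_
    rw [Set.disjoint_iUnion₂_right]
    intro i hi
    exact hS a (Finset.mem_insert_self a I) i (Finset.mem_insert_of_mem hi)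
      (by rintro rfl; exact ha hi)

theorem units_int_le_iff (a b : ℤˣ) : a ≤ b ↔ (a = 1 → b = 1) := by
  revert a b
  decide

/-- Harris' inequality: increasing events are positively correlated. -/
theorem uniformProb_mul_le_inter {A B : Set (V → ℤˣ)} (hA : IsUpperSet A) (hB : IsUpperSet B) :
    uniformProb A * uniformProb B ≤ uniformProb (A ∩ B) := by
  classical
  -- Encoding a configuration by its set of `1`s reduces the claim to the correlation inequality for
  -- upper families of finite sets.
  let e : Finset V → (V → ℤˣ) := fun s v => if v ∈ s then 1 else -1
  have he : Function.Bijective e := by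
    constructor
    · intro s t hst
      ext v
      have := congrFun hst v
      by_cases h1 : v ∈ s <;> by_cases h2 : v ∈ t <;> simp_all [e]
    · intro ξ
      refine ⟨Finset.univ.filter fun v => ξ v = 1, funext fun v => ?_⟩
      rcases Int.units_eq_one_or (ξ v) with h | h <;> simp [e, h]
  have hmono : Monotone e := by
    intro s t hst v
    rw [units_int_le_iff]
    intro h
    have : v ∈ s := by by_contra h'; simp [e, h'] at h
    simp [e, hst this]
  let F : Set (V → ℤˣ) → Finset (Finset V) := fun C => Finset.univ.filter fun s => e s ∈ C
  have hF : ∀ C, IsUpperSet C → IsUpperSet (F C : Set (Finset V)) := by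
    intro C hC s t hst hs
    simp only [F, Finset.coe_filter, Finset.mem_univ, true_and, Set.mem_ofPred_eq] at hs ⊢
    exact hC (hmono hst) hs
  have hcard : ∀ C, ((F C).card : ℝ) = C.ncard := by
    intro C
    have h1 := Set.ncard_preimage_of_injective_subset_range (f := e) (s := C) he.1
      (by rw [he.2.range_eq]; simp)
    rw [← h1, ← Set.ncard_coe_finset]
    congr 2
    ext s
    simp [F]
  have hinter : F A ∩ F B = F (A ∩ B) := by
    ext s
    simp [F]
  have h := (hF A hA).le_card_inter_finset (hF B hB)
  have hV : Fintype.card (V → ℤˣ) = 2 ^ Fintype.card V := by simp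
  rw [hinter, ← hV] at h
  have h' : (A.ncard : ℝ) * B.ncard ≤ Fintype.card (V → ℤˣ) * (A ∩ B).ncard := by
    rw [← hcard, ← hcard, ← hcard]
    exact_mod_cast h
  rw [uniformProb_eq_ncard_div, uniformProb_eq_ncard_div, uniformProb_eq_ncard_div,
    div_mul_div_comm, div_le_div_iff₀ (mul_pos card_config_pos card_config_pos) card_config_pos]
  nlinarith [card_config_pos (V := V)]

theorem pow_le_uniformProb_biInter {ι : Type*} (I : Finset ι) {A : ι → Set (V → ℤˣ)} {p : ℝ}
    (hp : 0 ≤ p) (hA : ∀ i ∈ I, IsUpperSet (A i)) (hpA : ∀ i ∈ I, p ≤ uniformProb (A i)) :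
    p ^ I.card ≤ uniformProb (⋂ i ∈ I, A i) := by
  classical
  induction I using Finset.induction_on with
  | empty => simp [uniformProb_univ]
  | insert a I ha ih =>
    rw [Finset.card_insert_of_notMem ha, Finset.set_biInter_insert, pow_succ, mul_comm]
    refine le_trans ?_ (uniformProb_mul_le_inter (hA a (Finset.mem_insert_self a I))
      (isUpperSet_iInter₂ fun i hi => hA i (Finset.mem_insert_of_mem hi)))
    exact mul_le_mul (hpA a (Finset.mem_insert_self a I))
      (ih (fun i hi => hA i (Finset.mem_insert_of_mem hi))
        fun i hi => hpA i (Finset.mem_insert_of_mem hi))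
      (pow_nonneg hp _) (uniformProb_nonneg _)

end UniformProb

/-! ### Monotonicity, symmetry and forced dynamics. -/

section Majority

variable {V : Type*} [Fintype V] {G : SimpleGraph V} [DecidableRel G.Adj]

theorem majorityStep_eq_one_iff {ξ : V → ℤˣ} {v : V} :
    majorityStep G ξ v = 1 ↔ 0 < ∑ j ∈ G.neighborFinset v, (ξ j : ℤ) := by
  unfold majorityStep
  split_ifs with h <;> simp [h]

theorem majorityStep_eq_neg_one_iff {ξ : V → ℤˣ} {v : V} :
    majorityStep G ξ v = -1 ↔ ∑ j ∈ G.neighborFinset v, (ξ j : ℤ) ≤ 0 := by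
  unfold majorityStep
  split_ifs with h
  · simpa using h
  · simpa using h

theorem neg_one_le_units_int (a : ℤˣ) : (-1 : ℤ) ≤ a := by
  rcases Int.units_eq_one_or a with rfl | rfl <;> decide

theorem units_int_le_one (a : ℤˣ) : (a : ℤ) ≤ 1 := by
  rcases Int.units_eq_one_or a with rfl | rfl <;> decide

theorem units_int_eq_neg_of_ne {a b : ℤˣ} (h : a ≠ b) : a = -b := by
  revert a b
  decide

/-- If a strict majority of the neighbours hold opinion `s`, then so does the vertex next. -/
theorem majorityStep_eq_of_card_lt {ξ : V → ℤˣ} {v : V} {s : ℤˣ} {C : Finset V}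
    (hC : C ⊆ G.neighborFinset v) (hs : ∀ x ∈ C, ξ x = s) (hcard : G.degree v < 2 * C.card) :
    majorityStep G ξ v = s := by
  classical
  have hsplit := Finset.sum_sdiff (f := fun j => (ξ j : ℤ)) hC
  have hsum : ∑ j ∈ C, (ξ j : ℤ) = C.card * (s : ℤ) := by
    rw [Finset.sum_congr rfl fun x hx => by rw [hs x hx], Finset.sum_const, nsmul_eq_mul]
  have hrest : ((G.neighborFinset v \ C).card : ℤ) = G.degree v - C.card := by
    rw [Finset.card_sdiff_of_subset hC, SimpleGraph.card_neighborFinset_eq_degree,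
      Nat.cast_sub]
    rw [← SimpleGraph.card_neighborFinset_eq_degree]
    exact Finset.card_le_card hC
  have hlow : -((G.neighborFinset v \ C).card : ℤ) ≤ ∑ j ∈ G.neighborFinset v \ C, (ξ j : ℤ) := by
    have := Finset.card_nsmul_le_sum (G.neighborFinset v \ C) (fun j => (ξ j : ℤ)) (-1)
      fun x _ => neg_one_le_units_int _
    simpa using this
  have hup : ∑ j ∈ G.neighborFinset v \ C, (ξ j : ℤ) ≤ (G.neighborFinset v \ C).card := by
    have := Finset.sum_le_card_nsmul (G.neighborFinset v \ C) (fun j => (ξ j : ℤ)) 1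
      fun x _ => units_int_le_one _
    simpa using this
  rcases Int.units_eq_one_or s with rfl | rfl
  · rw [majorityStep_eq_one_iff]
    push_cast at hsum
    omega
  · rw [majorityStep_eq_neg_one_iff]
    push_cast at hsum
    omega

theorem majorityStep_mono : Monotone (majorityStep G) := by
  intro ξ η h v
  rw [units_int_le_iff, majorityStep_eq_one_iff, majorityStep_eq_one_iff]
  intro h0
  exact h0.trans_le (Finset.sum_le_sum fun j _ => Units.val_le_val.2 (h j))

theorem odd_sum_units {ι : Type*} (s : Finset ι) (f : ι → ℤˣ) (hs : Odd s.card) :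
    Odd (∑ j ∈ s, (f j : ℤ)) := by
  have h : (2 : ℤ) ∣ ∑ j ∈ s, ((f j : ℤ) - 1) := by
    refine Finset.dvd_sum fun j _ => ?_
    rcases Int.units_eq_one_or (f j) with h | h <;> rw [h] <;> decide
  rw [Finset.sum_sub_distrib, Finset.sum_const, nsmul_eq_mul, mul_one] at h
  obtain ⟨a, ha⟩ := hs
  obtain ⟨b, hb⟩ := h
  exact ⟨b + a, by rw [ha] at hb; push_cast at hb; omega⟩

/-- Odd degrees exclude ties, the only place where the rule is not symmetric. -/
theorem majorityStep_neg (hodd : ∀ v, Odd (G.degree v)) (ξ : V → ℤˣ) :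
    majorityStep G (-ξ) = -majorityStep G ξ := by
  funext v
  have h := odd_sum_units (G.neighborFinset v) ξ
    (by rw [SimpleGraph.card_neighborFinset_eq_degree]; exact hodd v)
  have hne : ∑ j ∈ G.neighborFinset v, (ξ j : ℤ) ≠ 0 := by
    intro h0
    rw [h0] at h
    exact absurd h (by decide)
  rw [Pi.neg_apply]
  rcases Int.units_eq_one_or (majorityStep G ξ v) with h1 | h1
  · rw [h1, majorityStep_eq_neg_one_iff]
    rw [majorityStep_eq_one_iff] at h1
    simp only [Pi.neg_apply, Units.val_neg, Finset.sum_neg_distrib]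
    omega
  · rw [h1, neg_neg, majorityStep_eq_one_iff]
    rw [majorityStep_eq_neg_one_iff] at h1
    simp only [Pi.neg_apply, Units.val_neg, Finset.sum_neg_distrib]
    omega

variable [DecidableEq V]

/-- Majority dynamics in which the vertex `w` holds opinion `c` at all times. -/
def forcedOpinionAt (G : SimpleGraph V) [DecidableRel G.Adj] (w : V) (c : ℤˣ) (ξ₀ : V → ℤˣ) :
    ℕ → V → ℤˣ
  | 0 => Function.update ξ₀ w c
  | t + 1 => Function.update (majorityStep G (forcedOpinionAt G w c ξ₀ t)) w c

theorem forcedOpinionAt_mono {w : V} {c c' : ℤˣ} {ξ η : V → ℤˣ} (hc : c ≤ c') (h : ξ ≤ η) (t : ℕ) :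
    forcedOpinionAt G w c ξ t ≤ forcedOpinionAt G w c' η t := by
  induction t with
  | zero => exact update_le_update_iff.2 ⟨hc, fun j _ => h j⟩
  | succ t ih => exact update_le_update_iff.2 ⟨hc, fun j _ => majorityStep_mono ih j⟩

theorem forcedOpinionAt_neg (hodd : ∀ v, Odd (G.degree v)) (w : V) (c : ℤˣ) (ξ : V → ℤˣ) (t : ℕ) :
    forcedOpinionAt G w (-c) (-ξ) t = -forcedOpinionAt G w c ξ t := by
  have hup : ∀ ζ : V → ℤˣ, Function.update (-ζ) w (-c) = -Function.update ζ w c := by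
    intro ζ
    funext v
    by_cases hv : v = w
    · subst hv; simp
    · simp [hv]
  induction t with
  | zero => exact hup ξ
  | succ t ih => rw [forcedOpinionAt, ih, majorityStep_neg hodd, hup, forcedOpinionAt]

theorem forcedOpinionAt_eq_opinionAt {w : V} {c : ℤˣ} {ξ : V → ℤˣ} {t : ℕ}
    (h : ∀ s ≤ t, opinionAt G ξ s w = c) : forcedOpinionAt G w c ξ t = opinionAt G ξ t := by
  induction t with
  | zero => rw [forcedOpinionAt, ← h 0 le_rfl]; exact Function.update_eq_self w ξ
  | succ t ih =>
    rw [forcedOpinionAt, ih fun s hs => h s (hs.trans (Nat.le_succ t)), ← h (t + 1) le_rfl]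
    exact Function.update_eq_self w _

/-- The forced vertex `w` carries no information, so nothing enters a set whose only outside
neighbour is `w`. -/
theorem dependsOn_forcedOpinionAt {w : V} {c : ℤˣ} {S : Set V}
    (hS : ∀ v ∈ S, ∀ u, G.Adj v u → u ∈ S ∨ u = w) (t : ℕ) {v : V} (hv : v ∈ S) :
    DependsOn (fun ξ => forcedOpinionAt G w c ξ t v) S := by
  intro ξ η h
  simp only
  induction t generalizing v with
  | zero =>
    by_cases hvw : v = w
    · subst hvw; simp [forcedOpinionAt]
    · simp [forcedOpinionAt, hvw, h v hv]
  | succ t ih =>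
    by_cases hvw : v = w
    · subst hvw; simp [forcedOpinionAt]
    · have hsum : ∑ j ∈ G.neighborFinset v, (forcedOpinionAt G w c ξ t j : ℤ) =
          ∑ j ∈ G.neighborFinset v, (forcedOpinionAt G w c η t j : ℤ) := by
        refine Finset.sum_congr rfl fun u hu => ?_
        rw [SimpleGraph.mem_neighborFinset] at hu
        rcases hS v hv u hu with hu | rfl
        · rw [ih hu]
        · cases t <;> simp [forcedOpinionAt]
      simp only [forcedOpinionAt, Function.update_of_ne hvw, majorityStep, hsum]

theorem isUpperSet_forcedOpinionAt (w : V) (t : ℕ) (x : V) :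
    IsUpperSet {ξ : V → ℤˣ | forcedOpinionAt G w 1 ξ t x = 1} := by
  intro ξ η h hξ
  exact (units_int_le_iff _ _).1 (forcedOpinionAt_mono le_rfl h t x) hξ

/-- If `ξ` fails, then by symmetry `-ξ` gives `1` even with `w` forced to `-1`, hence by
monotonicity also with `w` forced to `1`. So the complement is no likelier than the event. -/
theorem half_le_uniformProb_forcedOpinionAt (hodd : ∀ v, Odd (G.degree v)) (w : V) (t : ℕ)
    (x : V) : 1 / 2 ≤ uniformProb {ξ : V → ℤˣ | forcedOpinionAt G w 1 ξ t x = 1} := by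
  set A := {ξ : V → ℤˣ | forcedOpinionAt G w 1 ξ t x = 1} with hA
  have hsub : Aᶜ ⊆ {ξ | -ξ ∈ A} := by
    intro ξ hξ
    have h1 : forcedOpinionAt G w 1 ξ t x = -1 := units_int_eq_neg_of_ne hξ
    have h2 : forcedOpinionAt G w (-1) (-ξ) t x = 1 := by
      rw [forcedOpinionAt_neg hodd, Pi.neg_apply, h1, neg_neg]
    exact (units_int_le_iff _ _).1
      (forcedOpinionAt_mono (by decide : (-1 : ℤˣ) ≤ 1) (le_refl (-ξ)) t x) h2
  have h1 := uniformProb_mono hsub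
  rw [uniformProb_preimage_neg, uniformProb_compl] at h1
  linarith

/-- The initial opinions for which `w` starts from `s`, and for which all vertices of `C` hold
opinion `s` before time `L` if `w` does. -/
def frozenEvent (G : SimpleGraph V) [DecidableRel G.Adj] (C : Finset V) (L : ℕ) (w : V)
    (s : ℤˣ) : Set (V → ℤˣ) :=
  {ξ | ξ w = s ∧ ∀ x ∈ C, ∀ t < L, forcedOpinionAt G w s ξ t x = s}

/-- A bootstrap in time: while `w` has kept `s`, forced and true dynamics coincide, so the majority
`C` holds `s` and keeps `w` at `s` for one more step. -/
theorem opinionAt_of_mem_frozenEvent {C : Finset V} {L : ℕ} {w : V} {s : ℤˣ} {ξ : V → ℤˣ}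
    (hC : C ⊆ G.neighborFinset w) (hcard : G.degree w < 2 * C.card)
    (hξ : ξ ∈ frozenEvent G C L w s) {t : ℕ} (ht : t ≤ L) : opinionAt G ξ t w = s := by
  induction t using Nat.strong_induction_on with
  | _ t ih =>
    cases t with
    | zero => exact hξ.1
    | succ t =>
      have hpast : ∀ r ≤ t, opinionAt G ξ r w = s := fun r hr => ih r (by omega) (by omega)
      refine majorityStep_eq_of_card_lt hC (fun x hx => ?_) hcard
      rw [← forcedOpinionAt_eq_opinionAt hpast]
      exact hξ.2 x hx t (by omega)

theorem dependsOn_frozenEvent {C : Finset V} {L : ℕ} {w : V} {s : ℤˣ} {S : V → Set V} {S' : Set V}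
    (hw : w ∈ S') (hS' : ∀ x ∈ C, S x ⊆ S') (hself : ∀ x ∈ C, x ∈ S x)
    (hS : ∀ x ∈ C, ∀ v ∈ S x, ∀ u, G.Adj v u → u ∈ S x ∨ u = w) :
    DependsOn (fun ξ => ξ ∈ frozenEvent G C L w s) S' := by
  intro ξ η h
  simp only [frozenEvent, Set.mem_ofPred_eq, eq_iff_iff]
  refine and_congr (by rw [h w hw]) (forall₂_congr fun x hx => forall₂_congr fun t _ => ?_)
  have := dependsOn_forcedOpinionAt (c := s) (hS x hx) t (hself x hx) (x := ξ) (y := η)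
    fun v hv => h v (hS' x hx hv)
  simp only at this
  rw [this]

/-- The event intersects `1 + C.card * L` increasing events of probability at least `1 / 2`; Harris'
inequality multiplies the bounds although different times are dependent. -/
theorem pow_le_uniformProb_frozenEvent_one (hodd : ∀ v, Odd (G.degree v)) (C : Finset V) (L : ℕ)
    (w : V) : (1 / 2 : ℝ) ^ (1 + C.card * L) ≤ uniformProb (frozenEvent G C L w 1) := by
  have hEq : frozenEvent G C L w 1 = {ξ | ξ w = 1} ∩
      ⋂ p ∈ C ×ˢ Finset.range L, {ξ : V → ℤˣ | forcedOpinionAt G w 1 ξ p.2 p.1 = 1} := by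
    ext ξ
    simp only [frozenEvent, Set.mem_ofPred_eq, Set.mem_inter_iff, Set.mem_iInter,
      Finset.mem_product, Finset.mem_range, Prod.forall, and_imp]
    exact and_congr_right fun _ => ⟨fun h a b ha hb => h a ha b hb, fun h a ha b hb => h a b ha hb⟩
  have hup : IsUpperSet {ξ : V → ℤˣ | ξ w = 1} := fun ξ η h hξ => (units_int_le_iff _ _).1 (h w) hξ
  have h1 := pow_le_uniformProb_biInter (C ×ˢ Finset.range L)
    (A := fun p => {ξ : V → ℤˣ | forcedOpinionAt G w 1 ξ p.2 p.1 = 1}) (p := 1 / 2) (by norm_num)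
    (fun p _ => isUpperSet_forcedOpinionAt w p.2 p.1)
    (fun p _ => half_le_uniformProb_forcedOpinionAt hodd w p.2 p.1)
  rw [Finset.card_product, Finset.card_range] at h1
  rw [hEq, pow_add, pow_one]
  refine le_trans ?_ (uniformProb_mul_le_inter hup
    (isUpperSet_iInter₂ fun p _ => isUpperSet_forcedOpinionAt w p.2 p.1))
  rw [uniformProb_eval]
  gcongr

theorem pow_le_uniformProb_frozenEvent (hodd : ∀ v, Odd (G.degree v)) (C : Finset V) (L : ℕ)
    (w : V) (s : ℤˣ) : (1 / 2 : ℝ) ^ (1 + C.card * L) ≤ uniformProb (frozenEvent G C L w s) := by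
  have h := pow_le_uniformProb_frozenEvent_one hodd C L w
  rcases Int.units_eq_one_or s with rfl | rfl
  · exact h
  · rw [← uniformProb_preimage_neg]
    convert h using 2
    ext ξ
    simp only [frozenEvent, Set.mem_ofPred_eq, Pi.neg_apply, neg_inj]
    refine and_congr Iff.rfl (forall₂_congr fun x _ => forall₂_congr fun t _ => ?_)
    rw [forcedOpinionAt_neg hodd, Pi.neg_apply, neg_inj]

end Majority

/-! ### Upper bound: propagation of flips. -/

/-- If the sign of a sum changes, some summand changes strictly in the same direction. -/
theorem exists_adj_of_majorityStep_ne {V : Type*} [Fintype V] {G : SimpleGraph V}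
    [DecidableRel G.Adj] {ξ η : V → ℤˣ} {v : V} (h : majorityStep G ξ v ≠ majorityStep G η v) :
    ∃ u, G.Adj v u ∧ ξ u = majorityStep G ξ v ∧ η u = majorityStep G η v := by
  have key : ∀ ξ η : V → ℤˣ, majorityStep G ξ v = 1 → majorityStep G η v = -1 →
      ∃ u, G.Adj v u ∧ ξ u = 1 ∧ η u = -1 := by
    intro ξ η h1 h2
    rw [majorityStep_eq_one_iff] at h1
    rw [majorityStep_eq_neg_one_iff] at h2
    obtain ⟨u, hu, hlt⟩ := Finset.exists_lt_of_sum_lt (h2.trans_lt h1)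
    rw [SimpleGraph.mem_neighborFinset] at hu
    refine ⟨u, hu, ?_⟩
    rcases Int.units_eq_one_or (ξ u) with h | h <;> rcases Int.units_eq_one_or (η u) with h' | h' <;>
      rw [h, h'] at hlt <;> first | exact ⟨h, h'⟩ | exact absurd hlt (by decide)
  rcases Int.units_eq_one_or (majorityStep G ξ v) with h1 | h1 <;>
    rcases Int.units_eq_one_or (majorityStep G η v) with h2 | h2
  · exact absurd (h1.trans h2.symm) h
  · rw [h1, h2]; exact key ξ η h1 h2
  · rw [h1, h2]
    obtain ⟨u, hu, h3, h4⟩ := key η ξ h2 h1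
    exact ⟨u, hu, h4, h3⟩
  · exact absurd (h1.trans h2.symm) h

/-- The dynamics is deterministic, so 2-periodicity persists; hence a flip at time `t` forces the
stabilisation time to exceed `t`. -/
theorem opinionAt_add_two_eq_mono {V : Type*} [Fintype V] {G : SimpleGraph V}
    [DecidableRel G.Adj] {ξ : V → ℤˣ} {s t : ℕ} (hst : s ≤ t)
    (h : ∀ v, opinionAt G ξ (s + 2) v = opinionAt G ξ s v) (v : V) :
    opinionAt G ξ (t + 2) v = opinionAt G ξ t v := by
  have key : opinionAt G ξ (t + 2) = opinionAt G ξ t := by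
    induction t, hst using Nat.le_induction with
    | base => exact funext h
    | succ t _ ih =>
      rw [show t + 1 + 2 = (t + 2) + 1 from rfl, opinionAt, ih, opinionAt]
  rw [key]

namespace IsPerfectRooting

variable {V : Type*} [Fintype V] [DecidableEq V] {T : SimpleGraph V} [DecidableRel T.Adj]
  {R : V} {k n : ℕ} {par : V → V} {d : V → ℕ}

theorem neighborFinset_leaf (h : IsPerfectRooting T R k n par d) (hn : 0 < n) {v : V}
    (hv : d v = n) : T.neighborFinset v = {par v} := by
  have hvR : v ≠ R := h.ne_root (by omega)
  have h1 := h.degree_eq_card_childrenOf_add_one hvR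
  rw [h.degree_leaf v hv] at h1
  have h2 : childrenOf R par v = ∅ := by
    rw [← Finset.card_eq_zero]; omega
  rw [h.neighborFinset_eq hvR, h2]
  rfl

theorem opinionAt_leaf (h : IsPerfectRooting T R k n par d) (hn : 0 < n) (ξ : V → ℤˣ) (t : ℕ)
    {v : V} (hv : d v = n) : opinionAt T ξ (t + 1) v = opinionAt T ξ t (par v) := by
  rw [opinionAt]
  apply majorityStep_eq_of_card_lt (C := {par v})
  · rw [h.neighborFinset_leaf hn hv]
  · simp
  · rw [h.degree_leaf v hv]; simp

/-- The parents of the leaves are `2`-periodic from the start. -/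
theorem opinionAt_add_two_of_depth (h : IsPerfectRooting T R k n par d) (hn : 2 ≤ n) (hk : 2 ≤ k)
    (ξ : V → ℤˣ) (t : ℕ) {v : V} (hv : d v + 1 = n) :
    opinionAt T ξ (t + 2) v = opinionAt T ξ t v := by
  have hvR : v ≠ R := h.ne_root (by omega)
  have hc := h.card_childrenOf hvR (by omega)
  rw [show t + 2 = (t + 1) + 1 from rfl, opinionAt]
  -- The `k` leaf children echo the opinion of `v` at time `t` and outvote its parent.
  apply majorityStep_eq_of_card_lt (h.childrenOf_subset_neighborFinset v)
  · intro x hx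
    rw [h.opinionAt_leaf (by omega) ξ t (by rw [h.depth_of_mem_childrenOf hx, hv]),
      (mem_childrenOf.1 hx).2]
  · rw [h.degree_inner v (by omega), hc]
    omega

/-- A change of opinion travels along a path of the tree which first goes up and then down. -/
theorem flip_bound (h : IsPerfectRooting T R k n par d) (hn : 2 ≤ n) (hk : 2 ≤ k)
    (ξ : V → ℤˣ) (t : ℕ) {v : V} (hv : d v ≠ n)
    (hflip : opinionAt T ξ (t + 2) v ≠ opinionAt T ξ t v) :
    d v + 2 ≤ n ∧ (d v + t + 2 ≤ n ∨
      v ≠ R ∧ opinionAt T ξ (t + 1) (par v) = opinionAt T ξ (t + 2) v ∧ t + 2 ≤ n + d v) := by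
  have hdepth : ∀ (t : ℕ) (v : V), d v ≠ n → opinionAt T ξ (t + 2) v ≠ opinionAt T ξ t v →
      d v + 2 ≤ n := by
    intro t v hv hflip
    by_contra hlt
    have := h.depth_le v
    exact hflip (h.opinionAt_add_two_of_depth hn hk ξ t (by omega))
  induction t generalizing v with
  | zero =>
    have := hdepth 0 v hv hflip
    exact ⟨this, Or.inl this⟩
  | succ t ih =>
    have hdv := hdepth (t + 1) v hv hflip
    refine ⟨hdv, ?_⟩
    obtain ⟨u, hvu, hu1, hu2⟩ := exists_adj_of_majorityStep_ne
      (ξ := opinionAt T ξ (t + 2)) (η := opinionAt T ξ t) (v := v) hflip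
    have huflip : opinionAt T ξ (t + 2) u ≠ opinionAt T ξ t u := by
      rw [hu1, hu2]; exact hflip
    have hul : d u ≠ n := by
      intro hul
      rcases (h.adj_iff v u).1 hvu with ⟨huR, hp⟩ | ⟨hvR, hp⟩
      · have := h.depth_par_add_one huR
        rw [hp] at this
        omega
      · have := h.depth_par_add_one hvR
        rw [hp] at this
        omega
    obtain ⟨-, hcase⟩ := ih hul huflip
    rcases (h.adj_iff v u).1 hvu with ⟨huR, rfl⟩ | ⟨hvR, rfl⟩
    · have hd := h.depth_par_add_one huR
      left
      rcases hcase with h1 | ⟨-, h1, -⟩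
      · omega
      -- The child `u` flipped to the opinion its parent `v` already had at time `t + 1`, so it
      -- cannot make `v` flip away from that opinion.
      · exact absurd (hu1.symm.trans h1.symm) hflip
    · have hd := h.depth_par_add_one hvR
      right
      refine ⟨hvR, hu1, ?_⟩
      rcases hcase with h1 | ⟨-, -, h1⟩ <;> omega

theorem opinionAt_add_two_of_le (h : IsPerfectRooting T R k n par d) (hn : 2 ≤ n) (hk : 2 ≤ k)
    (ξ : V → ℤˣ) {t : ℕ} (ht : 2 * n ≤ t + 3) (v : V) :
    opinionAt T ξ (t + 2) v = opinionAt T ξ t v := by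
  by_contra hflip
  by_cases hv : d v = n
  · obtain ⟨s, rfl⟩ : ∃ s, t = s + 1 := ⟨t - 1, by omega⟩
    apply hflip
    have hp := h.depth_par_add_one (h.ne_root (v := v) (by omega))
    rw [show s + 1 + 2 = (s + 2) + 1 from rfl, h.opinionAt_leaf (by omega) ξ _ hv,
      h.opinionAt_leaf (by omega) ξ _ hv, h.opinionAt_add_two_of_depth hn hk ξ s (by omega)]
  · have := h.flip_bound hn hk ξ t hv hflip
    omega

theorem exists_isStabilisationTime (h : IsPerfectRooting T R k n par d) (hn : 2 ≤ n) (hk : 2 ≤ k)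
    (ξ : V → ℤˣ) : ∃ τ, IsStabilisationTime T ξ τ ∧ τ ≤ 2 * n - 3 := by
  classical
  have hmem : ∀ v, opinionAt T ξ (2 * n - 3 + 2) v = opinionAt T ξ (2 * n - 3) v :=
    h.opinionAt_add_two_of_le hn hk ξ (by omega)
  have hex : ∃ t, ∀ v, opinionAt T ξ (t + 2) v = opinionAt T ξ t v := ⟨_, hmem⟩
  exact ⟨Nat.find hex, ⟨Nat.find_spec hex, fun t ht => Nat.find_min' hex ht⟩,
    Nat.find_min' hex hmem⟩

end IsPerfectRooting

/-! ### Lower bound: waves along descending paths. -/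

section Wave

variable {V : Type*} [Fintype V] [DecidableEq V]

/-- The event that `v` starts from opinion `s` and `A x` holds for each child `x` of `v`. -/
def branchEvent (R : V) (par : V → V) (v : V) (s : ℤˣ) (A : V → Set (V → ℤˣ)) : Set (V → ℤˣ) :=
  {ξ | ξ v = s} ∩ ⋂ x ∈ childrenOf R par v, A x

theorem dependsOn_branchEvent {R : V} {par : V → V} {v : V} {s : ℤˣ}
    {A : V → Set (V → ℤˣ)}
    (hA : ∀ x ∈ childrenOf R par v, DependsOn (fun ξ => ξ ∈ A x) (descendants par x)) :
    DependsOn (fun ξ => ξ ∈ branchEvent R par v s A) (descendants par v) := by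
  intro ξ η h
  have h1 := dependsOn_eval v s (x := ξ) (y := η)
    fun i hi => h i (by rw [Set.mem_singleton_iff.1 hi]; exact IsRooting.self_mem_descendants v)
  have h2 := dependsOn_mem_biInter hA (x := ξ) (y := η) fun i hi => by
    obtain ⟨x, hx, hi⟩ := Set.mem_iUnion₂.1 hi
    exact h i (IsRooting.descendants_subset (IsRooting.mem_descendants_of_mem_childrenOf hx) hi)
  simp only [branchEvent, Set.mem_inter_iff] at h1 h2 ⊢
  rw [h1, h2]

theorem IsRooting.uniformProb_branchEvent {T : SimpleGraph V} {R : V} {par : V → V} {d : V → ℕ}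
    (h : IsRooting T R par d) {v : V} {s : ℤˣ}
    {A : V → Set (V → ℤˣ)}
    (hA : ∀ x ∈ childrenOf R par v, DependsOn (fun ξ => ξ ∈ A x) (descendants par x)) :
    uniformProb (branchEvent R par v s A) =
      1 / 2 * ∏ x ∈ childrenOf R par v, uniformProb (A x) := by
  rw [branchEvent, uniformProb_inter_of_dependsOn (dependsOn_eval v s) (dependsOn_mem_biInter hA),
    uniformProb_eval, uniformProb_biInter_of_dependsOn _ hA]
  · intro x hx y hy hxy
    refine h.disjoint_descendants ?_ hxy
    rw [h.depth_of_mem_childrenOf hx, h.depth_of_mem_childrenOf hy]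
  · rw [Set.disjoint_singleton_left, Set.mem_iUnion₂]
    rintro ⟨x, hx, hv⟩
    exact h.notMem_descendants_child hx hv

variable (T : SimpleGraph V) [DecidableRel T.Adj] (R : V) (par : V → V)

/-- The descending path `v, a v, a (a v), …` of length `i` starts from opinions `-1` except for its
last vertex, and the children of each path vertex which are off the path are frozen until time `L`,
those in `B` in opinion `1` and the others in opinion `-1`. -/
def waveEvent (a : V → V) (B : V → Finset V) (L : ℕ) : ℕ → V → Set (V → ℤˣ)
  | 0, v => {ξ | ξ v = 1}
  | i + 1, v => branchEvent R par v (-1) fun x =>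
      if x = a v then waveEvent a B L i x
      else frozenEvent T (childrenOf R par x) L x (if x ∈ B v then 1 else -1)

/-- The child `a r` of `r` starts a wave, and all other children of `r` are frozen in
opinion `-1`. -/
def topEvent (a : V → V) (B : V → Finset V) (L : ℕ) (r : V) : Set (V → ℤˣ) :=
  branchEvent R par r (-1) fun x =>
    if x = a r then waveEvent T R par a B L L x
    else frozenEvent T (childrenOf R par x) L x (-1)

variable {T R par}

namespace IsRooting

variable {d : V → ℕ}

theorem dependsOn_frozenEvent_descendants (h : IsRooting T R par d) (L : ℕ) (w : V) (s : ℤˣ) :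
    DependsOn (fun ξ => ξ ∈ frozenEvent T (childrenOf R par w) L w s) (descendants par w) := by
  refine dependsOn_frozenEvent (S := fun x => descendants par x) (self_mem_descendants w)
    (fun x hx => descendants_subset (mem_descendants_of_mem_childrenOf hx))
    (fun x _ => self_mem_descendants x) fun x hx v hv u hvu => ?_
  rw [← (mem_childrenOf.1 hx).2]
  exact h.adj_descendants hv hvu

theorem dependsOn_waveEvent (h : IsRooting T R par d) (a : V → V) (B : V → Finset V) (L i : ℕ)
    (v : V) : DependsOn (fun ξ => ξ ∈ waveEvent T R par a B L i v) (descendants par v) := by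
  induction i generalizing v with
  | zero =>
    exact (dependsOn_eval v 1).mono (Set.singleton_subset_iff.2 (self_mem_descendants v))
  | succ i ih =>
    refine dependsOn_branchEvent fun x _ => ?_
    by_cases hx : x = a v
    · simp only [if_pos hx]; exact ih x
    · simp only [if_neg hx]; exact h.dependsOn_frozenEvent_descendants L x _

theorem dependsOn_topEvent (h : IsRooting T R par d) (a : V → V) (B : V → Finset V) (L : ℕ)
    (r : V) : DependsOn (fun ξ => ξ ∈ topEvent T R par a B L r) (descendants par r) := by
  refine dependsOn_branchEvent fun x _ => ?_
  by_cases hx : x = a r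
  · simp only [if_pos hx]; exact h.dependsOn_waveEvent a B L L x
  · simp only [if_neg hx]; exact h.dependsOn_frozenEvent_descendants L x _

end IsRooting

/-- `a` selects a child, and `B` selects `k / 2` of the other children. -/
structure IsSelection (R : V) (par : V → V) (d : V → ℕ) (k n : ℕ) (a : V → V)
    (B : V → Finset V) : Prop where
  mem : ∀ v, v ≠ R → d v < n → a v ∈ childrenOf R par v
  subset : ∀ v, v ≠ R → d v < n → B v ⊆ (childrenOf R par v).erase (a v)
  card : ∀ v, v ≠ R → d v < n → 2 * (B v).card = k

namespace IsPerfectRooting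

variable {k n : ℕ} {d : V → ℕ}

theorem exists_isSelection (h : IsPerfectRooting T R k n par d) (hk : Even k) (hk2 : 2 ≤ k) :
    ∃ a B, IsSelection R par d k n a B := by
  have hex : ∀ v, ∃ x : V, ∃ C : Finset V, v ≠ R → d v < n →
      x ∈ childrenOf R par v ∧ C ⊆ (childrenOf R par v).erase x ∧ 2 * C.card = k := by
    intro v
    by_cases hv : v ≠ R ∧ d v < n
    · have hc := h.card_childrenOf hv.1 hv.2
      obtain ⟨x, hx⟩ := Finset.card_pos.1 (by omega : 0 < (childrenOf R par v).card)
      obtain ⟨C, hC, hCc⟩ := Finset.exists_subset_card_eq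
        (s := (childrenOf R par v).erase x) (n := k / 2)
        (by rw [Finset.card_erase_of_mem hx]; omega)
      exact ⟨x, C, fun _ _ => ⟨hx, hC, by rw [hCc]; exact Nat.two_mul_div_two_of_even hk⟩⟩
    · exact ⟨v, ∅, fun h1 h2 => absurd ⟨h1, h2⟩ hv⟩
  choose a B hab using hex
  exact ⟨a, B, fun v h1 h2 => (hab v h1 h2).1, fun v h1 h2 => (hab v h1 h2).2.1,
    fun v h1 h2 => (hab v h1 h2).2.2⟩

theorem card_childrenOf_le (h : IsPerfectRooting T R k n par d) {v : V} (hv : v ≠ R) :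
    (childrenOf R par v).card ≤ k := by
  rcases (h.depth_le v).lt_or_eq with h1 | h1
  · exact (h.card_childrenOf hv h1).le
  · have h2 := h.degree_eq_card_childrenOf_add_one hv
    rw [h.degree_leaf v h1] at h2
    omega

theorem le_uniformProb_frozenEvent (h : IsPerfectRooting T R k n par d) (hk : Even k) (L : ℕ)
    {w : V} (hw : w ≠ R) (s : ℤˣ) :
    (1 / 2 : ℝ) ^ (1 + k * L) ≤ uniformProb (frozenEvent T (childrenOf R par w) L w s) := by
  refine le_trans ?_ (pow_le_uniformProb_frozenEvent (h.odd_degree hk) _ L w s)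
  apply pow_le_pow_of_le_one (by norm_num) (by norm_num)
  have := Nat.mul_le_mul_right L (h.card_childrenOf_le hw)
  omega

/-- The `k - 1` children other than `y` give `k - 1` factors `f`; the remaining factor `f` absorbs
the `1 / 2` for the initial opinion of `v`. -/
theorem le_uniformProb_branchEvent (h : IsPerfectRooting T R k n par d) {v y : V} (hv : v ≠ R)
    (hd : d v < n) {s : ℤˣ} {A : V → Set (V → ℤˣ)} {f q : ℝ} (hf : 0 ≤ f) (hf2 : f ≤ 1 / 2)
    (hq : 0 ≤ q) (hy : y ∈ childrenOf R par v)
    (hA : ∀ x ∈ childrenOf R par v, DependsOn (fun ξ => ξ ∈ A x) (descendants par x))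
    (hfA : ∀ x ∈ childrenOf R par v, x ≠ y → f ≤ uniformProb (A x))
    (hqA : q ≤ uniformProb (A y)) :
    f ^ k * q ≤ uniformProb (branchEvent R par v s A) := by
  rw [h.uniformProb_branchEvent hA, ← Finset.mul_prod_erase _ _ hy]
  have hcard : ((childrenOf R par v).erase y).card = k - 1 := by
    rw [Finset.card_erase_of_mem hy, h.card_childrenOf hv hd]
  have hk : 0 < k := by
    rw [← h.card_childrenOf hv hd]; exact Finset.card_pos.2 ⟨y, hy⟩
  have hprod : f ^ (k - 1) ≤ ∏ x ∈ (childrenOf R par v).erase y, uniformProb (A x) := by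
    rw [← hcard, ← Finset.prod_const]
    refine Finset.prod_le_prod (fun _ _ => hf) fun x hx => ?_
    obtain ⟨hxy, hx⟩ := Finset.mem_erase.1 hx
    exact hfA x hx hxy
  calc f ^ k * q = f * (q * f ^ (k - 1)) := by
        rw [← Nat.sub_add_cancel (Nat.one_le_iff_ne_zero.2 hk.ne'), pow_succ]
        simp only [Nat.add_sub_cancel]
        ring
    _ ≤ _ := by
        have := uniformProb_nonneg (A y)
        gcongr

theorem le_uniformProb_waveEvent (h : IsPerfectRooting T R k n par d) (hk : Even k)
    {a : V → V} {B : V → Finset V} (hs : IsSelection R par d k n a B) (L i : ℕ) {v : V}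
    (hv : v ≠ R) (hd : d v + i < n) :
    ((1 / 2 : ℝ) ^ (1 + k * L)) ^ (1 + k * i) ≤ uniformProb (waveEvent T R par a B L i v) := by
  have hf2 : (1 / 2 : ℝ) ^ (1 + k * L) ≤ 1 / 2 := by
    rw [pow_add, pow_one]
    exact mul_le_of_le_one_right (by norm_num) (pow_le_one₀ (by norm_num) (by norm_num))
  induction i generalizing v with
  | zero =>
    rw [waveEvent, uniformProb_eval, mul_zero, add_zero, pow_one]
    exact hf2
  | succ i ih =>
    have ha := hs.mem v hv (by omega)
    have hda := h.depth_of_mem_childrenOf ha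
    rw [show 1 + k * (i + 1) = k + (1 + k * i) by ring, pow_add _ k]
    refine h.le_uniformProb_branchEvent (y := a v) hv (by omega) (by positivity) hf2
      (by positivity) ha (fun x _ => ?_) (fun x hx hxa => ?_) ?_
    · by_cases hx : x = a v
      · simp only [if_pos hx]; exact h.dependsOn_waveEvent a B L i x
      · simp only [if_neg hx]; exact h.dependsOn_frozenEvent_descendants L x _
    · rw [if_neg hxa]
      exact h.le_uniformProb_frozenEvent hk L (mem_childrenOf.1 hx).1 _
    · rw [if_pos rfl]
      exact ih (mem_childrenOf.1 ha).1 (by omega)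

theorem le_uniformProb_topEvent (h : IsPerfectRooting T R k n par d) (hk : Even k)
    {a : V → V} {B : V → Finset V} (hs : IsSelection R par d k n a B) (L : ℕ) {r : V}
    (hr : r ≠ R) (hd : d r + L + 1 < n) :
    ((1 / 2 : ℝ) ^ (1 + k * L)) ^ (1 + k * (L + 1)) ≤
      uniformProb (topEvent T R par a B L r) := by
  have hf2 : (1 / 2 : ℝ) ^ (1 + k * L) ≤ 1 / 2 := by
    rw [pow_add, pow_one]
    exact mul_le_of_le_one_right (by norm_num) (pow_le_one₀ (by norm_num) (by norm_num))
  have ha := hs.mem r hr (by omega)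
  have hda := h.depth_of_mem_childrenOf ha
  rw [show 1 + k * (L + 1) = k + (1 + k * L) by ring, pow_add _ k]
  refine h.le_uniformProb_branchEvent (y := a r) hr (by omega) (by positivity) hf2
    (by positivity) ha (fun x _ => ?_) (fun x hx hxa => ?_) ?_
  · by_cases hx : x = a r
    · simp only [if_pos hx]; exact h.dependsOn_waveEvent a B L L x
    · simp only [if_neg hx]; exact h.dependsOn_frozenEvent_descendants L x _
  · rw [if_neg hxa]
    exact h.le_uniformProb_frozenEvent hk L (mem_childrenOf.1 hx).1 _
  · rw [if_pos rfl]
    exact h.le_uniformProb_waveEvent hk hs L L (mem_childrenOf.1 ha).1 (by omega)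

theorem opinionAt_of_frozen (h : IsPerfectRooting T R k n par d) (hk : 2 ≤ k) {L : ℕ} {w : V}
    (hw : w ≠ R) (hd : d w < n) {s : ℤˣ} {ξ : V → ℤˣ}
    (hξ : ξ ∈ frozenEvent T (childrenOf R par w) L w s) {t : ℕ} (ht : t ≤ L) :
    opinionAt T ξ t w = s := by
  refine opinionAt_of_mem_frozenEvent (h.childrenOf_subset_neighborFinset w) ?_ hξ ht
  rw [h.degree_inner w hd, h.card_childrenOf hw hd]
  omega

/-- On a wave path the opinions off the path add up to `1`. -/
theorem sum_neighborFinset_of_mem_waveEvent (h : IsPerfectRooting T R k n par d) (hk : 2 ≤ k)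
    {a : V → V} {B : V → Finset V} (hs : IsSelection R par d k n a B) {L i : ℕ} {v : V}
    (hv : v ≠ R) (hd : d v + 1 < n) {ξ : V → ℤˣ}
    (hξ : ξ ∈ waveEvent T R par a B L (i + 1) v) {t : ℕ} (ht : t ≤ L) :
    ∑ u ∈ T.neighborFinset v, (opinionAt T ξ t u : ℤ) =
      opinionAt T ξ t (par v) + opinionAt T ξ t (a v) + 1 := by
  have hdv : d v < n := by omega
  have ha := hs.mem v hv hdv
  rw [h.sum_neighborFinset hv, ← Finset.add_sum_erase _ _ ha, add_assoc]
  congr 2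
  have hval : ∀ x ∈ (childrenOf R par v).erase (a v),
      (opinionAt T ξ t x : ℤ) = if x ∈ B v then 1 else -1 := by
    intro x hx
    obtain ⟨hxa, hxc⟩ := Finset.mem_erase.1 hx
    have h1 := Set.mem_iInter₂.1 hξ.2 x hxc
    beta_reduce at h1
    rw [if_neg hxa] at h1
    rw [h.opinionAt_of_frozen hk (mem_childrenOf.1 hxc).1
      (by rw [h.depth_of_mem_childrenOf hxc]; exact hd) h1 ht]
    split_ifs <;> rfl
  -- Of the `k - 1` off-path children, `k / 2` hold `1` and `k / 2 - 1` hold `-1`.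
  rw [Finset.sum_congr rfl hval, ← Finset.sum_sdiff (hs.subset v hv hdv),
    Finset.sum_congr rfl (g := fun _ => (-1 : ℤ))
      (fun x hx => if_neg (Finset.mem_sdiff.1 hx).2),
    Finset.sum_congr (s₁ := B v) rfl (g := fun _ => (1 : ℤ)) (fun x hx => if_pos hx),
    Finset.sum_const, Finset.sum_const, Finset.card_sdiff_of_subset (hs.subset v hv hdv),
    Finset.card_erase_of_mem ha, h.card_childrenOf hv hdv]
  have := hs.card v hv hdv
  simp only [nsmul_eq_mul]
  omega

/-- With off-path sum `1`, a path child at `1` suffices whatever the parent does, so the front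
climbs one edge per step. -/
theorem opinionAt_eq_one_of_mem_waveEvent (h : IsPerfectRooting T R k n par d) (hk : 2 ≤ k)
    {a : V → V} {B : V → Finset V} (hs : IsSelection R par d k n a B) {L i : ℕ} {v : V}
    (hv : v ≠ R) (hd : d v + i < n) (hi : i ≤ L) {ξ : V → ℤˣ}
    (hξ : ξ ∈ waveEvent T R par a B L i v) : opinionAt T ξ i v = 1 := by
  induction i generalizing v with
  | zero => exact hξ
  | succ i ih =>
    have ha := hs.mem v hv (by omega)
    have h1 := Set.mem_iInter₂.1 hξ.2 (a v) ha
    beta_reduce at h1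
    rw [if_pos rfl] at h1
    have hda := h.depth_of_mem_childrenOf ha
    have h2 := ih (mem_childrenOf.1 ha).1 (by omega) (by omega) h1
    rw [opinionAt, majorityStep_eq_one_iff,
      h.sum_neighborFinset_of_mem_waveEvent hk hs hv (by omega) hξ (by omega), h2]
    have := neg_one_le_units_int (opinionAt T ξ i (par v))
    push_cast
    omega

/-- The front cannot arrive early: a path vertex turns to `1` only through its parent or its path
child. The induction is on time, since the path child in turn needs `v` to have been `-1` earlier.
-/
theorem opinionAt_eq_neg_one_of_mem_waveEvent (h : IsPerfectRooting T R k n par d) (hk : 2 ≤ k)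
    {a : V → V} {B : V → Finset V} (hs : IsSelection R par d k n a B) {L i t : ℕ} {v : V}
    (hv : v ≠ R) (hd : d v + i < n) (hi : i ≤ L) (ht : t < i) {ξ : V → ℤˣ}
    (hξ : ξ ∈ waveEvent T R par a B L i v)
    (hpar : ∀ s < t, opinionAt T ξ s (par v) = -1) : opinionAt T ξ t v = -1 := by
  induction t using Nat.strong_induction_on generalizing i v with
  | _ t ih =>
    obtain ⟨i, rfl⟩ : ∃ j, i = j + 1 := ⟨i - 1, by omega⟩
    cases t with
    | zero => exact hξ.1
    | succ t =>
      have ha := hs.mem v hv (by omega)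
      have h1 := Set.mem_iInter₂.1 hξ.2 (a v) ha
      beta_reduce at h1
      rw [if_pos rfl] at h1
      have hda := h.depth_of_mem_childrenOf ha
      have h2 : opinionAt T ξ t (a v) = -1 := by
        refine ih t (Nat.lt_succ_self t) (mem_childrenOf.1 ha).1 (by omega) (by omega) (by omega)
          h1 fun s hs => ?_
        rw [(mem_childrenOf.1 ha).2]
        exact ih s (by omega) hv hd hi (by omega) hξ fun u hu => hpar u (by omega)
      rw [opinionAt, majorityStep_eq_neg_one_iff,
        h.sum_neighborFinset_of_mem_waveEvent hk hs hv (by omega) hξ (by omega), h2,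
        hpar t (Nat.lt_succ_self t)]
      norm_num

theorem exists_opinionAt_ne_of_mem_topEvent (h : IsPerfectRooting T R k n par d) (hk : 4 ≤ k)
    {a : V → V} {B : V → Finset V} (hs : IsSelection R par d k n a B) {L : ℕ} {r : V}
    (hr : r ≠ R) (hd : d r + L + 3 < n) {ξ : V → ℤˣ}
    (hξ : ξ ∈ topEvent T R par a B (L + 2) r) :
    ∃ v, opinionAt T ξ (L + 2) v ≠ opinionAt T ξ L v := by
  have ha := hs.mem r hr (by omega)
  have hda := h.depth_of_mem_childrenOf ha
  have h1 := Set.mem_iInter₂.1 hξ.2 (a r) ha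
  beta_reduce at h1
  rw [if_pos rfl] at h1
  have htop : ∀ s ≤ L + 2, opinionAt T ξ s r = -1 := by
    intro s hsL
    cases s with
    | zero => exact hξ.1
    | succ s =>
      refine majorityStep_eq_of_card_lt (C := (childrenOf R par r).erase (a r))
        ((Finset.erase_subset _ _).trans (h.childrenOf_subset_neighborFinset r)) ?_ ?_
      · intro x hx
        obtain ⟨hxa, hxc⟩ := Finset.mem_erase.1 hx
        have h2 := Set.mem_iInter₂.1 hξ.2 x hxc
        beta_reduce at h2
        rw [if_neg hxa] at h2
        exact h.opinionAt_of_frozen (by omega) (mem_childrenOf.1 hxc).1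
          (by rw [h.depth_of_mem_childrenOf hxc]; omega) h2 (by omega)
      -- Here `4 ≤ k` is needed: the `k - 1` frozen children must outvote the parent and the path
      -- child together.
      · rw [h.degree_inner r (by omega), Finset.card_erase_of_mem ha,
          h.card_childrenOf hr (by omega)]
        omega
  refine ⟨a r, ?_⟩
  rw [h.opinionAt_eq_one_of_mem_waveEvent (by omega) hs (mem_childrenOf.1 ha).1 (by omega) le_rfl h1,
    h.opinionAt_eq_neg_one_of_mem_waveEvent (t := L) (by omega) hs (mem_childrenOf.1 ha).1
      (by omega) le_rfl (by omega) h1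
      fun s hs => by rw [(mem_childrenOf.1 ha).2]; exact htop s (by omega)]
  decide

/-- With high probability some top event at depth `m` occurs. -/
theorem le_uniformProb_exists_opinionAt_ne (h : IsPerfectRooting T R k n par d) (hk : Even k)
    (hk4 : 4 ≤ k) {L m : ℕ} (hm : 0 < m) (hmn : m + L + 3 < n) :
    1 - (1 - ((1 / 2 : ℝ) ^ (1 + k * (L + 2))) ^ (1 + k * (L + 3))) ^ (k ^ m) ≤
      uniformProb {ξ | ∃ v, opinionAt T ξ (L + 2) v ≠ opinionAt T ξ L v} := by
  obtain ⟨a, B, hs⟩ := h.exists_isSelection hk (by omega)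
  set p : ℝ := ((1 / 2 : ℝ) ^ (1 + k * (L + 2))) ^ (1 + k * (L + 3)) with hp
  have hp1 : p ≤ 1 := pow_le_one₀ (by positivity) (pow_le_one₀ (by norm_num) (by norm_num))
  have hp0 : 0 ≤ p := by positivity
  set I : Finset V := Finset.univ.filter fun v => d v = m with hI
  have hmem : ∀ r ∈ I, r ≠ R ∧ d r = m := by
    intro r hr
    have := (Finset.mem_filter.1 hr).2
    exact ⟨h.ne_root (by omega), this⟩
  have hdep : ∀ r ∈ I, DependsOn (fun ξ => ξ ∈ (topEvent T R par a B (L + 2) r)ᶜ)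
      (descendants par r) := by
    intro r _ ξ η hξη
    have := h.dependsOn_topEvent a B (L + 2) r hξη
    simp only [Set.mem_compl_iff] at this ⊢
    rw [this]
  -- Subtrees below distinct vertices of the same depth are disjoint, so the failures are
  -- independent.
  have hind := uniformProb_biInter_of_dependsOn I hdep fun r hr r' hr' hne =>
    h.disjoint_descendants ((hmem r hr).2.trans (hmem r' hr').2.symm) hne
  have hle : uniformProb (⋂ r ∈ I, (topEvent T R par a B (L + 2) r)ᶜ) ≤ (1 - p) ^ (k ^ m) := by
    rw [hind]
    calc ∏ r ∈ I, uniformProb (topEvent T R par a B (L + 2) r)ᶜ ≤ ∏ _r ∈ I, (1 - p) := by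
          refine Finset.prod_le_prod (fun _ _ => uniformProb_nonneg _) fun r hr => ?_
          rw [uniformProb_compl]
          have := h.le_uniformProb_topEvent hk hs (L + 2) (hmem r hr).1
            (by rw [(hmem r hr).2]; omega)
          linarith
      _ = (1 - p) ^ I.card := by rw [Finset.prod_const]
      _ ≤ _ := pow_le_pow_of_le_one (by linarith) (by linarith)
          (h.pow_le_card_depth (by omega))
  have hsub : (⋂ r ∈ I, (topEvent T R par a B (L + 2) r)ᶜ)ᶜ ⊆
      {ξ | ∃ v, opinionAt T ξ (L + 2) v ≠ opinionAt T ξ L v} := by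
    intro ξ hξ
    rw [Set.mem_compl_iff, Set.mem_iInter₂] at hξ
    push Not at hξ
    obtain ⟨r, hr, hξ⟩ := hξ
    rw [Set.mem_compl_iff, not_not] at hξ
    exact h.exists_opinionAt_ne_of_mem_topEvent hk4 hs (hmem r hr).1
      (by rw [(hmem r hr).2]; omega) hξ
  have := uniformProb_mono hsub
  rw [uniformProb_compl] at this
  linarith

end IsPerfectRooting

end Wave

/-! ### Numerical estimates and conclusion. -/

/-- The power is at most `exp (-(p * N))`, and `1 / ε ≤ x ≤ exp x ≤ p * N ≤ exp (p * N)` crudely. -/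
theorem one_sub_pow_le_of_exp_le {p x ε : ℝ} {N : ℕ} (hp : p ≤ 1) (hε : 0 < ε)
    (hx : Real.exp x ≤ p * N) (hxε : 1 / ε ≤ x) : (1 - p) ^ N ≤ ε := by
  have h1 : 1 - p ≤ Real.exp (-p) := by
    have := Real.add_one_le_exp (-p)
    linarith
  have h2 : 1 / ε ≤ Real.exp (p * N) := by
    have e1 := Real.add_one_le_exp x
    have e2 := Real.add_one_le_exp (p * N)
    linarith
  calc (1 - p) ^ N ≤ Real.exp (-p) ^ N := pow_le_pow_left₀ (by linarith) h1 N
    _ = (Real.exp (p * N))⁻¹ := by rw [← Real.exp_nat_mul, ← Real.exp_neg]; congr 1; ring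
    _ ≤ (1 / ε)⁻¹ := inv_anti₀ (by positivity) h2
    _ = ε := by simp

theorem wave_length_bounds {k n : ℕ} {y : ℝ} (hk : 4 ≤ k) (hn0 : (20 : ℝ) ≤ n)
    (hy : y = 1 / 10 * (Real.sqrt (Real.log k) / k) * Real.sqrt (2 * n)) :
    (k : ℝ) ^ 2 * y ^ 2 = 2 / 100 * n * Real.log k ∧ y ≤ n / 5 := by
  have hk' : (4 : ℝ) ≤ k := by exact_mod_cast hk
  have hk0 : (0 : ℝ) < k := by linarith
  have hlog0 : 0 ≤ Real.log k := Real.log_nonneg (by linarith)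
  have hlogk : Real.log k ≤ k := (Real.log_le_sub_one_of_pos hk0).trans (by linarith)
  have hsq : (k : ℝ) ^ 2 * y ^ 2 = 2 / 100 * n * Real.log k := by
    rw [hy, mul_pow, mul_pow, div_pow, div_pow, Real.sq_sqrt (x := Real.log k) hlog0,
      Real.sq_sqrt (by positivity)]
    field_simp
    ring
  have hyn : y ≤ n / 5 := by
    have hA : (k : ℝ) ^ 2 * y ^ 2 ≤ (k : ℝ) ^ 2 * (n / 5) ^ 2 := by
      rw [hsq]
      nlinarith [mul_le_mul hlogk hn0 (by norm_num) hk0.le, mul_pos hk0 hk0,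
        mul_nonneg hk0.le (mul_nonneg (by linarith : (0:ℝ) ≤ n) (by linarith : (0:ℝ) ≤ k - 4)),
        mul_nonneg (by linarith : (0 : ℝ) ≤ n) (by linarith : (0 : ℝ) ≤ k - Real.log k),
        mul_nonneg (mul_pos hk0 hk0).le (mul_nonneg (by linarith : (0 : ℝ) ≤ n)
          (by linarith : (0 : ℝ) ≤ n - 20))]
    have hB := le_of_mul_le_mul_left hA (by positivity)
    exact le_of_sq_le_sq hB (by positivity)
  exact ⟨hsq, hyn⟩

/-- Among the `k ^ m` vertices at depth `m`, some event of probability `2 ^ (-O((k L) ^ 2))` occurs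
with high probability, for `L` of order `√(log k) / k * √n`. -/
theorem wave_failure_le {k n L m : ℕ} {ε y : ℝ} (hk : 4 ≤ k) (hε : 0 < ε)
    (hn : 2 * (36 * (k : ℝ) ^ 2 + 1 / ε) + 20 ≤ n)
    (hy : y = 1 / 10 * (Real.sqrt (Real.log k) / k) * Real.sqrt (2 * n))
    (hL : (L : ℝ) ≤ y) (hm : (m : ℝ) = n - L - 4) :
    (1 - ((1 / 2 : ℝ) ^ (1 + k * (L + 2))) ^ (1 + k * (L + 3))) ^ (k ^ m) ≤ ε := by
  have hk' : (4 : ℝ) ≤ k := by exact_mod_cast hk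
  have hk0 : (0 : ℝ) < k := by linarith
  have hn0 : (20 : ℝ) ≤ n := by
    have : 0 < 1 / ε := by positivity
    nlinarith [sq_nonneg (k : ℝ)]
  have hlog1 : 1 ≤ Real.log k := by
    rw [Real.le_log_iff_exp_le hk0]
    linarith [Real.exp_one_lt_d9]
  have hlogk : Real.log k ≤ k := (Real.log_le_sub_one_of_pos hk0).trans (by linarith)
  have hy0 : 0 ≤ y := by rw [hy]; positivity
  obtain ⟨hsq, hyn⟩ := wave_length_bounds hk hn0 hy
  -- Both factors are at most `k * (y + 4)`, and `(y + 4) ^ 2 ≤ 2 * y ^ 2 + 32`.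
  have hEle : ((1 + k * (L + 2) : ℕ) * (1 + k * (L + 3) : ℕ) : ℝ) ≤
      4 / 100 * n * Real.log k + 32 * k ^ 2 := by
    have e1 : ((1 + k * (L + 2) : ℕ) : ℝ) ≤ k * (y + 4) := by push_cast; nlinarith
    have e2 : ((1 + k * (L + 3) : ℕ) : ℝ) ≤ k * (y + 4) := by push_cast; nlinarith
    calc _ ≤ (k * (y + 4)) * (k * (y + 4)) :=
          mul_le_mul e1 e2 (Nat.cast_nonneg _) (by positivity)
      _ ≤ 2 * (k ^ 2 * y ^ 2) + 32 * k ^ 2 := by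
          nlinarith [mul_nonneg (sq_nonneg (k : ℝ)) (sq_nonneg (y - 4))]
      _ = _ := by rw [hsq]; ring
  refine one_sub_pow_le_of_exp_le
    (x := m * Real.log k - ((1 + k * (L + 2) : ℕ) * (1 + k * (L + 3) : ℕ) : ℝ))
    (pow_le_one₀ (by positivity) (pow_le_one₀ (by norm_num) (by norm_num))) hε ?_ ?_
  · rw [← pow_mul, sub_eq_neg_add, Real.exp_add, Nat.cast_pow]
    have e1 : Real.exp (m * Real.log k) = (k : ℝ) ^ m := by
      rw [Real.exp_nat_mul, Real.exp_log hk0]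
    rw [e1, ← Nat.cast_mul]
    refine mul_le_mul_of_nonneg_right ?_ (by positivity)
    rw [Real.exp_neg, one_div, inv_pow]
    apply inv_anti₀ (by positivity)
    calc (2 : ℝ) ^ ((1 + k * (L + 2)) * (1 + k * (L + 3)))
        ≤ Real.exp 1 ^ ((1 + k * (L + 2)) * (1 + k * (L + 3))) :=
          pow_le_pow_left₀ (by norm_num) (by linarith [Real.add_one_le_exp (1 : ℝ)]) _
      _ = _ := by rw [← Real.exp_nat_mul, mul_one]
  -- As `L ≤ n / 5`, the gain `m * log k` beats the cost by at least `n / 2 - 4 * log k - 32 * k ^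
  -- 2`; the `36 * k ^ 2` in `hn` absorbs both error terms.
  · have e1 : (n * (4 / 5) - 4) * Real.log k ≤ m * Real.log k := by
      apply mul_le_mul_of_nonneg_right _ (by linarith)
      rw [hm]
      linarith
    have e2 : (n : ℝ) * (1 / 2) ≤ n * (76 / 100) * Real.log k := by nlinarith
    nlinarith

theorem theorem3 :
    ∃ c : ℝ, 0 < c ∧ ∀ k : ℕ, Even k → 4 ≤ k → ∀ ε : ℝ, 0 < ε →
      ∃ D₀ : ℕ, ∀ (V : Type*) [Fintype V] [DecidableEq V] (T : SimpleGraph V)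
        [DecidableRel T.Adj] (R : V),
        IsPerfectKAryTree T R k → D₀ ≤ T.diam →
          1 - ε ≤ uniformProb {ξ₀ : V → ℤˣ | ∃ τ : ℕ, IsStabilisationTime T ξ₀ τ ∧
            c * (Real.sqrt (Real.log (k : ℝ)) / (k : ℝ)) * Real.sqrt (T.diam : ℝ) < (τ : ℝ) ∧
            (τ : ℝ) ≤ (T.diam : ℝ) - 3} := by
  refine ⟨1 / 10, by norm_num, fun k hkeven hk ε hε => ?_⟩
  refine ⟨2 * ⌈2 * (36 * (k : ℝ) ^ 2 + 1 / ε) + 20⌉₊, ?_⟩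
  intro V _ _ T _ R hT hD
  obtain ⟨n, par, h⟩ := hT.exists_isPerfectRooting (by omega)
  have hn0 : 0 < n := by
    have := h.depth_le R
    by_contra hn
    have hne : Nonempty V := ⟨R⟩
    have hall : ∀ v, v = R := fun v => (h.depth_eq_zero v).1 (by have := h.depth_le v; omega)
    have h1 := h.degree_leaf R (by omega)
    obtain ⟨u, hu⟩ := (T.degree_pos_iff_exists_adj R).1 (by omega)
    exact hu.ne (hall u).symm
  have hdiam : T.diam = 2 * n := IsPerfectKAryTree.diam_eq hT.isTree h (by omega) hn0
  have hn : 2 * (36 * (k : ℝ) ^ 2 + 1 / ε) + 20 ≤ n :=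
    (Nat.le_ceil _).trans (by exact_mod_cast (by omega :
      ⌈2 * (36 * (k : ℝ) ^ 2 + 1 / ε) + 20⌉₊ ≤ n))
  rw [hdiam]
  push_cast
  set y : ℝ := 1 / 10 * (Real.sqrt (Real.log k) / k) * Real.sqrt (2 * n) with hy
  have hn20 : (20 : ℝ) ≤ n := by
    have : 0 < 1 / ε := by positivity
    nlinarith [sq_nonneg (k : ℝ)]
  have hyn := (wave_length_bounds hk hn20 hy).2
  have hy0 : 0 ≤ y := by positivity
  have hL : (⌊y⌋₊ : ℝ) ≤ y := Nat.floor_le hy0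
  have hLn : ⌊y⌋₊ + 16 ≤ n := by
    have : (⌊y⌋₊ : ℝ) + 16 ≤ n := by linarith
    exact_mod_cast this
  have hfail := wave_failure_le (m := n - ⌊y⌋₊ - 4) hk hε hn hy hL (by
    rw [Nat.sub_sub, Nat.cast_sub (by omega)]
    push_cast
    ring)
  have hprob := h.le_uniformProb_exists_opinionAt_ne hkeven hk (L := ⌊y⌋₊) (m := n - ⌊y⌋₊ - 4)
    (by omega) (by omega)
  refine le_trans (by linarith) (hprob.trans (uniformProb_mono fun ξ hξ => ?_))
  obtain ⟨v, hv⟩ := hξ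
  obtain ⟨τ, hτ, hτn⟩ := h.exists_isStabilisationTime (by omega) (by omega) ξ
  -- The wave flips a vertex at time `⌊y⌋₊`, so `⌊y⌋₊ < τ`, which for an integer `τ` already means
  -- `y < τ`.
  refine ⟨τ, hτ, (Nat.floor_lt hy0).1 ?_, ?_⟩
  · by_contra hle
    exact hv (opinionAt_add_two_eq_mono (not_lt.1 hle) hτ.1 v)
  · have : τ + 3 ≤ 2 * n := by omega
    have : (τ : ℝ) + 3 ≤ 2 * n := by exact_mod_cast this
    linarith
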